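/- An open string $\alpha$ is a generic immersion $\alpha:\mathbb R\to\mathbb R^2$ with $\alpha(x)=(x,0)$ for $|x|$ sufficiently large, some of whose (finitely many, transverse) double points may be circled. Its Gauss diagram is the oriented line $\mathbb R$ with, for each uncircled double point $\alpha(s)=\alpha(t)$, $s\ne t$, an arrow $(s,t)$, ordered so that the curve near $s$ crosses the curve near $t$ from left to right. Two open strings are regarded as the same if they are related by flat generalized Reidemeister moves, equivalently if their Gauss diagrams are homotopic. An open string is classical if it has no circled double points. Let $F$ be the free group on generators $a_{\mathbf n}$, $\mathbf n\in\mathbb Z^2$, and let $u=(1,0)$, $v=(0,1)$. Let $\tilde{\mathcal A}_\alpha$ be the group with a family of generators $x_{\mathbf n}$ $(\mathbf n\in\mathbb Z^2)$ for each interval (arc) $x$ into which the endpoints of the arrows divide the line, and, for each arrow $(s,t)$, with $b,c$ the arcs just before and after $s$, and $a,d$ the arcs just before and after $t$, the relations $$a_{\mathbf n}b_{\mathbf n+u}=c_{\mathbf n}d_{\mathbf n+u}\quad(\mathbf n\in\mathbb Z^2),\qquad\text{and}\qquad \begin{cases} c_{\mathbf n+v}=b_{\mathbf n}\ (\mathbf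 n\in\mathbb Z^2) & \text{if } s<t,\\ a_{\mathbf n+v}=d_{\mathbf n}\ (\mathbf n\in\mathbb Z^2) & \text{if } t<s.\end{cases}$$ (This is the extended Alexander group of the long virtual knot given by the descending diagram of $\alpha$; the crossing of $(s,t)$ is positive if $s<t$ and negative if $t<s$.) The generators $(a_{-\infty})_{\mathbf n}$ of the leftmost arc freely generate $\tilde{\mathcal A}_\alpha$, so each generator $(a_{+\infty})_{\mathbf n}$ of the rightmost arc is uniquely a word in them; $\Phi(\alpha)$ is the endomorphism of $F$ that sends $a_{\mathbf n}$ to this word, with $(a_{-\infty})_{\mathbf m}$ read as $a_{\mathbf m}$. **Corollary 2.3.** If $\alpha$ is a classical open string, then $\Phi(\alpha)$ is the identity endomorphism of $F$. Consequently, if $\Phi(\alpha)$ is not the identity, then $\alpha$ is not the same as any classical open string. -/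

import Mathlib

noncomputable section

/-! ### Gauss diagrams -/

/-- A Gauss diagram: an oriented line with `2m` distinguished points partitioned into `m` ordered
pairs `(s, t)`, the arrows (tail `s`, head `t`). -/
structure GaussDiagram where
  arrows : Finset (ℝ × ℝ)
  ne : ∀ e ∈ arrows, e.1 ≠ e.2
  disjoint : ∀ e ∈ arrows, ∀ e' ∈ arrows, e ≠ e' →
    e.1 ≠ e'.1 ∧ e.1 ≠ e'.2 ∧ e.2 ≠ e'.1 ∧ e.2 ≠ e'.2

namespace GaussDiagram

/-- The distinguished points of the line. -/
def points (D : GaussDiagram) : Finset ℝ := D.arrows.image Prod.fst ∪ D.arrows.image Prod.snd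

/-- `D.FreeOn I`: no distinguished point of `D` lies in the set `I`. -/
def FreeOn (D : GaussDiagram) (I : Set ℝ) : Prop := ∀ x ∈ D.points, x ∉ I

/-- The elementary homotopies of Gauss diagrams: orientation preserving homeomorphisms of the line,
and the three flat Reidemeister moves. (A move that involves an encircled double point does not
change the Gauss diagram.) The moves may be performed in both directions, see `Homotopic`. -/
inductive Move : GaussDiagram → GaussDiagram → Prop
  /-- Reparametrization of the line. -/
  | reparam (D D' : GaussDiagram) (φ : ℝ ≃o ℝ)
      (h : D'.arrows = D.arrows.image (Prod.map φ φ)) : Move D D'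
  /-- First move: insert an isolated arrow, of either direction. -/
  | one (D D' : GaussDiagram) (s t : ℝ) (free : D.FreeOn (Set.uIcc s t))
      (h : D'.arrows = D.arrows ∪ {(s, t)}) : Move D D'
  /-- Second move. The strands `[a, a']` and `[b, b']` are pushed across each other and acquire two
  double points; the strands run parallel in the first case, antiparallel in the two others. -/
  | two (D D' : GaussDiagram) (a a' b b' : ℝ) (ha : a < a') (hb : b < b')
      (disj : Disjoint (Set.Icc a a') (Set.Icc b b'))
      (free : D.FreeOn (Set.Icc a a' ∪ Set.Icc b b'))
      (h : D'.arrows = D.arrows ∪ {(a, b), (b', a')} ∨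
        D'.arrows = D.arrows ∪ {(a, b'), (b, a')} ∨
        D'.arrows = D.arrows ∪ {(b', a), (a', b)}) : Move D D'
  /-- Third move. Each of the strands `[a, a']`, `[b, b']`, `[c, c']` crosses the two others, and
  on each of them the order of the two crossings is reversed. The first case is that of strands
  that cross one another cyclically from left to right (`a` crosses `b`, `b` crosses `c`, `c`
  crosses `a`), the second that of strands that do so transitively (`a` crosses `b` and `c`, and
  `b` crosses `c`). -/
  | three (D₀ D D' : GaussDiagram) (a a' b b' c c' : ℝ) (ha : a < a') (hb : b < b') (hc : c < c')
      (hab : Disjoint (Set.Icc a a') (Set.Icc b b'))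
      (hbc : Disjoint (Set.Icc b b') (Set.Icc c c'))
      (hac : Disjoint (Set.Icc a a') (Set.Icc c c'))
      (free : D₀.FreeOn (Set.Icc a a' ∪ Set.Icc b b' ∪ Set.Icc c c'))
      (h : (D.arrows = D₀.arrows ∪ {(a', b), (b', c), (c', a)} ∧
          D'.arrows = D₀.arrows ∪ {(a, b'), (b, c'), (c, a')}) ∨
        (D.arrows = D₀.arrows ∪ {(a, b), (a', c), (b', c')} ∧
          D'.arrows = D₀.arrows ∪ {(a', b'), (a, c'), (b, c)})) : Move D D'

/-- Homotopy of Gauss diagrams. -/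
def Homotopic : GaussDiagram → GaussDiagram → Prop := Relation.EqvGen Move

/-! ### The extended Alexander group

The distinguished points of `D` cut the line into `2m + 1` intervals, numbered `0, …, 2m` from left
to right. They are the arcs of the descending diagram: the overcrossing arcs are cut at the point
of overcrossing too, and virtual crossings do not cut. -/

/-- The number `2m` of distinguished points. -/
def size (D : GaussDiagram) : ℕ := D.points.card

/-- The arc that ends at the distinguished point `p`. -/
def before (D : GaussDiagram) (p : ℝ) : Fin (D.size + 1) :=
  ⟨(D.points.filter (· < p)).card, Nat.lt_succ_of_le (Finset.card_filter_le _ _)⟩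

/-- The arc that starts at the distinguished point `p`. -/
def after (D : GaussDiagram) (p : ℝ) : Fin (D.size + 1) :=
  ⟨(D.points.filter (· ≤ p)).card, Nat.lt_succ_of_le (Finset.card_filter_le _ _)⟩

/-- The relators of the extended Alexander group of the long virtual knot that is given by the
descending diagram over `D`. The generators are `x_n`, for `x` an arc and `n ∈ ℤ²`; `u = (1, 0)`
and `v = (0, 1)`. In the descending diagram the point of an arrow `(s, t)` that is visited first
lies on the overcrossing strand. As the strand of `s` crosses the strand of `t` from left to right,
the crossing is positive if `s < t` (the strand of `s` is over) and negative if `t < s`. With `b, c`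
the arcs before and after `s`, and `a, d` the arcs before and after `t`, the relations are
`a_n b_{n+u} = c_n d_{n+u}`, together with `c_{n+v} = b_n` at a positive crossing and
`a_{n+v} = d_n` at a negative one. -/
inductive Relator (D : GaussDiagram) : FreeGroup (Fin (D.size + 1) × (ℤ × ℤ)) → Prop
  | crossing (s t : ℝ) (h : (s, t) ∈ D.arrows) (n : ℤ × ℤ) :
      Relator D (FreeGroup.of (D.before t, n) * FreeGroup.of (D.before s, n + (1, 0)) *
        (FreeGroup.of (D.after s, n) * FreeGroup.of (D.after t, n + (1, 0)))⁻¹)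
  | positive (s t : ℝ) (h : (s, t) ∈ D.arrows) (hst : s < t) (n : ℤ × ℤ) :
      Relator D (FreeGroup.of (D.after s, n + (0, 1)) * (FreeGroup.of (D.before s, n))⁻¹)
  | negative (s t : ℝ) (h : (s, t) ∈ D.arrows) (hts : t < s) (n : ℤ × ℤ) :
      Relator D (FreeGroup.of (D.before t, n + (0, 1)) * (FreeGroup.of (D.after t, n))⁻¹)

/-- The extended Alexander group. -/
abbrev AlexanderGroup (D : GaussDiagram) : Type :=
  PresentedGroup {r | D.Relator r}

/-- The generator `x_n` of the extended Alexander group, for the arc `x`. -/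
def gen (D : GaussDiagram) (x : Fin (D.size + 1)) (n : ℤ × ℤ) : D.AlexanderGroup :=
  PresentedGroup.of (x, n)

/-- The homomorphism from the free group `F` on `a_n`, `n ∈ ℤ²`, to the extended Alexander group
that maps `a_n` to the left end generator `(a_{-∞})_n`. -/
def fromLeft (D : GaussDiagram) : FreeGroup (ℤ × ℤ) →* D.AlexanderGroup :=
  FreeGroup.lift fun n => D.gen 0 n

/-- The homomorphism from `F` to the extended Alexander group that maps `a_n` to the right end
generator `(a_{+∞})_n`. -/
def fromRight (D : GaussDiagram) : FreeGroup (ℤ × ℤ) →* D.AlexanderGroup :=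
  FreeGroup.lift fun n => D.gen (Fin.last D.size) n

/-! The left end generators freely generate the extended Alexander group. -/

theorem mem_points {D : GaussDiagram} {p : ℝ} :
    p ∈ D.points ↔ ∃ e ∈ D.arrows, p = e.1 ∨ p = e.2 := by
  simp only [points, Finset.mem_union, Finset.mem_image]
  constructor
  · rintro (⟨e, he, rfl⟩ | ⟨e, he, rfl⟩)
    exacts [⟨e, he, Or.inl rfl⟩, ⟨e, he, Or.inr rfl⟩]
  · rintro ⟨e, he, rfl | rfl⟩
    exacts [Or.inl ⟨e, he, rfl⟩, Or.inr ⟨e, he, rfl⟩]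

theorem fst_mem {D : GaussDiagram} {s t : ℝ} (h : (s, t) ∈ D.arrows) : s ∈ D.points :=
  mem_points.2 ⟨_, h, Or.inl rfl⟩

theorem snd_mem {D : GaussDiagram} {s t : ℝ} (h : (s, t) ∈ D.arrows) : t ∈ D.points :=
  mem_points.2 ⟨_, h, Or.inr rfl⟩

theorem after_val {D : GaussDiagram} {p : ℝ} (hp : p ∈ D.points) :
    (D.after p : ℕ) = (D.before p : ℕ) + 1 := by
  have : D.points.filter (· ≤ p) = insert p (D.points.filter (· < p)) := by
    ext x
    simp only [Finset.mem_filter, Finset.mem_insert, le_iff_lt_or_eq]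
    constructor
    · rintro ⟨h, h' | h'⟩
      exacts [Or.inr ⟨h, h'⟩, Or.inl h']
    · rintro (rfl | ⟨h, h'⟩)
      exacts [⟨hp, Or.inr rfl⟩, ⟨h, Or.inl h'⟩]
  simp only [after, before, this]
  rw [Finset.card_insert_of_notMem (by simp)]

theorem after_le_before {D : GaussDiagram} {p q : ℝ} (h : p < q) :
    (D.after p : ℕ) ≤ (D.before q : ℕ) := by
  refine Finset.card_le_card fun x hx => ?_
  simp only [Finset.mem_filter] at hx ⊢
  exact ⟨hx.1, lt_of_le_of_lt hx.2 h⟩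

theorem before_inj {D : GaussDiagram} {p q : ℝ} (hp : p ∈ D.points) (hq : q ∈ D.points)
    (h : (D.before p : ℕ) = D.before q) : p = q := by
  rcases lt_trichotomy p q with h' | h' | h'
  · have := after_le_before (D := D) h'
    have := after_val hp
    omega
  · exact h'
  · have := after_le_before (D := D) h'
    have := after_val hq
    omega

theorem exists_before {D : GaussDiagram} {k : ℕ} (hk : k < D.size) :
    ∃ p ∈ D.points, (D.before p : ℕ) = k := by
  let f : D.points → Fin D.size := fun p => ⟨D.before p.1, by
    have := after_val p.2
    have := (D.after p.1).2
    omega⟩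
  have hf : Function.Injective f := fun p q h =>
    Subtype.ext (before_inj p.2 q.2 (Fin.mk.inj_iff.1 h))
  have hb := (Fintype.bijective_iff_injective_and_card f).2
    ⟨hf, by rw [Fintype.card_coe, Fintype.card_fin, size]⟩
  obtain ⟨p, hp⟩ := hb.2 ⟨k, hk⟩
  exact ⟨p.1, p.2, congrArg Fin.val hp⟩

theorem gen_crossing {D : GaussDiagram} {s t : ℝ} (h : (s, t) ∈ D.arrows) (n : ℤ × ℤ) :
    D.gen (D.before t) n * D.gen (D.before s) (n + (1, 0)) =
      D.gen (D.after s) n * D.gen (D.after t) (n + (1, 0)) := by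
  have := PresentedGroup.one_of_mem (rels := {r | D.Relator r}) (Relator.crossing s t h n)
  rw [map_mul, map_inv, mul_inv_eq_one, map_mul, map_mul] at this
  exact this

theorem gen_positive {D : GaussDiagram} {s t : ℝ} (h : (s, t) ∈ D.arrows) (hst : s < t)
    (n : ℤ × ℤ) : D.gen (D.after s) (n + (0, 1)) = D.gen (D.before s) n := by
  have := PresentedGroup.one_of_mem (rels := {r | D.Relator r}) (Relator.positive s t h hst n)
  rw [map_mul, map_inv, mul_inv_eq_one] at this
  exact this

theorem gen_negative {D : GaussDiagram} {s t : ℝ} (h : (s, t) ∈ D.arrows) (hts : t < s)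
    (n : ℤ × ℤ) : D.gen (D.before t) (n + (0, 1)) = D.gen (D.after t) n := by
  have := PresentedGroup.one_of_mem (rels := {r | D.Relator r}) (Relator.negative s t h hts n)
  rw [map_mul, map_inv, mul_inv_eq_one] at this
  exact this

theorem gen_mem_range (D : GaussDiagram) (k : ℕ) : ∀ (x : Fin (D.size + 1)), (x : ℕ) = k →
    ∀ n, D.gen x n ∈ D.fromLeft.range := by
  induction k using Nat.strong_induction_on with
  | _ k ih =>
  intro x hx n
  rcases Nat.eq_zero_or_pos k with hk | hk
  · have : x = 0 := Fin.ext (by simp [hx, hk])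
    subst this
    exact ⟨FreeGroup.of n, by simp [fromLeft]⟩
  obtain ⟨p, hp, hpk⟩ := exists_before (D := D) (k := k - 1) (by have := x.2; omega)
  have hpa : x = D.after p := Fin.ext (by rw [after_val hp]; omega)
  subst hpa
  obtain ⟨⟨s, t⟩, he, hpe⟩ := mem_points.1 hp
  have hs := after_val (fst_mem he)
  have ht := after_val (snd_mem he)
  rcases lt_or_gt_of_ne (D.ne _ he) with hst | hts
  · have hlt := after_le_before (D := D) hst
    rcases hpe with rfl | rfl
    · have h := gen_positive he hst (n - (0, 1))
      rw [sub_add_cancel] at h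
      dsimp only at *
      rw [h]
      exact ih _ (by omega) _ rfl _
    · have h := gen_crossing he (n - (1, 0))
      rw [sub_add_cancel] at h
      dsimp only at *
      rw [← inv_mul_eq_iff_eq_mul] at h
      rw [← h]
      exact mul_mem (inv_mem (ih _ (by omega) _ rfl _))
        (mul_mem (ih _ (by omega) _ rfl _) (ih _ (by omega) _ rfl _))
  · have hlt := after_le_before (D := D) hts
    rcases hpe with rfl | rfl
    · have h := gen_crossing he n
      dsimp only at *
      rw [← mul_inv_eq_iff_eq_mul] at h
      rw [← h]
      exact mul_mem (mul_mem (ih _ (by omega) _ rfl _) (ih _ (by omega) _ rfl _))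
        (inv_mem (ih _ (by omega) _ rfl _))
    · have h := gen_negative he hts n
      dsimp only at *
      rw [← h]
      exact ih _ (by omega) _ rfl _

theorem fromLeft_surjective (D : GaussDiagram) : Function.Surjective D.fromLeft := by
  rw [← MonoidHom.range_eq_top, eq_top_iff, ← PresentedGroup.closure_range_of,
    Subgroup.closure_le]
  rintro _ ⟨⟨x, n⟩, rfl⟩
  exact gen_mem_range D x x rfl n

/-- Words for the arcs that satisfy the relations at all points before the arc `k`. -/
theorem exists_words (D : GaussDiagram) (k : ℕ) : k ≤ D.size →
    ∃ w : ℕ → ℤ × ℤ → FreeGroup (ℤ × ℤ), w 0 = FreeGroup.of ∧ ∀ s t, (s, t) ∈ D.arrows →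
      (s < t → (D.after s : ℕ) ≤ k → ∀ n, w (D.after s) (n + (0, 1)) = w (D.before s) n) ∧
      (t < s → (D.after t : ℕ) ≤ k → ∀ n, w (D.before t) (n + (0, 1)) = w (D.after t) n) ∧
      ((D.after s : ℕ) ≤ k → (D.after t : ℕ) ≤ k → ∀ n,
        w (D.before t) n * w (D.before s) (n + (1, 0)) =
          w (D.after s) n * w (D.after t) (n + (1, 0))) := by
  induction k with
  | zero =>
    intro _
    refine ⟨fun _ => FreeGroup.of, rfl, fun s t h => ?_⟩
    have hs := after_val (fst_mem h)
    have ht := after_val (snd_mem h)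
    refine ⟨fun _ h' => ?_, fun _ h' => ?_, fun h' => ?_⟩ <;> omega
  | succ k ih =>
    intro hk
    obtain ⟨w, hw0, hw⟩ := ih (by omega)
    obtain ⟨p, hp, hpk⟩ := exists_before (D := D) (k := k) (by omega)
    have hpa := after_val hp
    obtain ⟨⟨s₀, t₀⟩, he, hpe⟩ := mem_points.1 hp
    have hs₀ := after_val (fst_mem he)
    have ht₀ := after_val (snd_mem he)
    -- it is enough to find the word of the new arc
    suffices H : ∃ g : ℤ × ℤ → FreeGroup (ℤ × ℤ), ∀ w' : ℕ → ℤ × ℤ → FreeGroup (ℤ × ℤ),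
        w' (k + 1) = g → (∀ i ≤ k, w' i = w i) →
        (s₀ < t₀ → (D.after s₀ : ℕ) ≤ k + 1 →
          ∀ n, w' (D.after s₀) (n + (0, 1)) = w' (D.before s₀) n) ∧
        (t₀ < s₀ → (D.after t₀ : ℕ) ≤ k + 1 →
          ∀ n, w' (D.before t₀) (n + (0, 1)) = w' (D.after t₀) n) ∧
        ((D.after s₀ : ℕ) ≤ k + 1 → (D.after t₀ : ℕ) ≤ k + 1 → ∀ n,
          w' (D.before t₀) n * w' (D.before s₀) (n + (1, 0)) =
            w' (D.after s₀) n * w' (D.after t₀) (n + (1, 0))) by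
      obtain ⟨g, hg⟩ := H
      have hold : ∀ i ≤ k, Function.update w (k + 1) g i = w i := fun i hi =>
        Function.update_of_ne (by omega) _ _
      refine ⟨Function.update w (k + 1) g, by rw [hold 0 (by omega), hw0], fun s t h => ?_⟩
      by_cases hst : (s, t) = (s₀, t₀)
      · obtain ⟨rfl, rfl⟩ := Prod.mk.inj hst
        exact hg _ (Function.update_self _ _ _) hold
      · have hs := after_val (fst_mem h)
        have ht := after_val (snd_mem h)
        obtain ⟨d1, d2, d3, d4⟩ := D.disjoint _ h _ he hst
        have hsk : (D.before s : ℕ) ≠ k := fun h' => by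
          have := before_inj (fst_mem h) hp (h'.trans hpk.symm)
          rcases hpe with rfl | rfl
          exacts [d1 this, d2 this]
        have htk : (D.before t : ℕ) ≠ k := fun h' => by
          have := before_inj (snd_mem h) hp (h'.trans hpk.symm)
          rcases hpe with rfl | rfl
          exacts [d3 this, d4 this]
        obtain ⟨h1, h2, h3⟩ := hw s t h
        refine ⟨fun a b => ?_, fun a b => ?_, fun a b => ?_⟩
        · rw [hold _ (by omega), hold _ (by omega)]
          exact h1 a (by omega)
        · rw [hold _ (by omega), hold _ (by omega)]
          exact h2 a (by omega)
        · rw [hold _ (by omega), hold _ (by omega), hold _ (by omega), hold _ (by omega)]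
          exact h3 (by omega) (by omega)
    obtain ⟨h1, h2, h3⟩ := hw _ _ he
    rcases lt_or_gt_of_ne (D.ne _ he) with hst | hts
    · have hlt := after_le_before (D := D) hst
      dsimp only at *
      rcases hpe with rfl | rfl
      · refine ⟨fun n => w k (n - (0, 1)), fun w' hg hold => ⟨fun _ _ n => ?_, fun a => ?_,
          fun a b => ?_⟩⟩
        · rw [hpa, hpk, hg, hold k le_rfl]
          dsimp only
          rw [add_sub_cancel_right]
        · exact absurd a (lt_asymm hst)
        · omega
      · refine ⟨fun n => (w (D.after s₀) (n - (1, 0)))⁻¹ * (w (D.before p) (n - (1, 0)) *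
          w (D.before s₀) n), fun w' hg hold => ⟨fun a _ n => ?_, fun a => ?_, fun _ _ n => ?_⟩⟩
        · rw [hold _ (by omega), hold _ (by omega)]
          exact h1 a (by omega) n
        · exact absurd a (lt_asymm hst)
        · rw [hpa, hpk, hg, hold k le_rfl, hold _ (by omega), hold _ (by omega), hpk]
          dsimp only
          rw [add_sub_cancel_right]
          group
    · have hlt := after_le_before (D := D) hts
      dsimp only at *
      rcases hpe with rfl | rfl
      · refine ⟨fun n => w (D.before t₀) n * w (D.before p) (n + (1, 0)) *
          (w (D.after t₀) (n + (1, 0)))⁻¹,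
          fun w' hg hold => ⟨fun a => ?_, fun a _ n => ?_, fun _ _ n => ?_⟩⟩
        · exact absurd a (lt_asymm hts)
        · rw [hold _ (by omega), hold _ (by omega)]
          exact h2 a (by omega) n
        · rw [hpa, hpk, hg, hold k le_rfl, hold _ (by omega), hold _ (by omega), hpk]
          group
      · refine ⟨fun n => w k (n + (0, 1)), fun w' hg hold => ⟨fun a => ?_, fun _ _ n => ?_,
          fun a b => ?_⟩⟩
        · exact absurd a (lt_asymm hts)
        · rw [hpa, hpk, hg, hold k le_rfl]
        · omega

theorem fromLeft_injective (D : GaussDiagram) : Function.Injective D.fromLeft := by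
  obtain ⟨w, hw0, hw⟩ := exists_words D D.size le_rfl
  have hle : ∀ x : Fin (D.size + 1), (x : ℕ) ≤ D.size := fun x => Nat.le_of_lt_succ x.2
  let f : Fin (D.size + 1) × (ℤ × ℤ) → FreeGroup (ℤ × ℤ) := fun y => w y.1 y.2
  have hf : ∀ r ∈ {r | D.Relator r}, FreeGroup.lift f r = 1 := by
    rintro r (⟨s, t, h, n⟩ | ⟨s, t, h, hst, n⟩ | ⟨s, t, h, hts, n⟩)
    · rw [map_mul, map_inv, mul_inv_eq_one]
      simpa [f] using (hw s t h).2.2 (hle _) (hle _) n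
    · rw [map_mul, map_inv, mul_inv_eq_one]
      simpa [f] using (hw s t h).1 hst (hle _) n
    · rw [map_mul, map_inv, mul_inv_eq_one]
      simpa [f] using (hw s t h).2.1 hts (hle _) n
  have hcomp : (PresentedGroup.toGroup hf).comp D.fromLeft = MonoidHom.id _ := by
    ext n
    simp [fromLeft, gen, f, hw0]
  exact Function.LeftInverse.injective (g := PresentedGroup.toGroup hf)
    fun x => DFunLike.congr_fun hcomp x

/-- The identification of `F` with the extended Alexander group through the left end generators. -/
def leftEquiv (D : GaussDiagram) : FreeGroup (ℤ × ℤ) ≃* D.AlexanderGroup :=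
  MulEquiv.ofBijective D.fromLeft ⟨D.fromLeft_injective, D.fromLeft_surjective⟩

/-- The endomorphism `Φ` of `F`: it maps `a_n` to the unique element of `F` that represents
`(a_{+∞})_n` as a word in the left end generators. -/
def Phi (D : GaussDiagram) : FreeGroup (ℤ × ℤ) →* FreeGroup (ℤ × ℤ) :=
  D.leftEquiv.symm.toMonoidHom.comp D.fromRight

end GaussDiagram

/-! ### Open strings -/

/-- The determinant of two vectors of the plane. -/
def planeDet (p q : ℝ × ℝ) : ℝ := p.1 * q.2 - p.2 * q.1

/-- An open (virtual) string: a generic immersion of the line in the plane, standard near `±∞`, some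
of whose double points are encircled. Generic means that there are finitely many double points, all
of them transverse, and no points of higher multiplicity. -/
structure OpenString where
  curve : ℝ → ℝ × ℝ
  smooth : ContDiff ℝ (⊤ : ℕ∞) curve
  immersion : ∀ x, deriv curve x ≠ 0
  standard : ∃ R : ℝ, ∀ x, R ≤ |x| → curve x = (x, 0)
  finite : {x | ∃ y, y ≠ x ∧ curve y = curve x}.Finite
  no_triple : ∀ x y z, curve x = curve y → curve y = curve z → x = y ∨ y = z ∨ x = z
  transverse : ∀ x y, x ≠ y → curve x = curve y → planeDet (deriv curve x) (deriv curve y) ≠ 0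
  circled : Set (ℝ × ℝ)
  circled_double : ∀ p ∈ circled, ∃ x y, x ≠ y ∧ curve x = p ∧ curve y = p

namespace OpenString

/-- The arrows of an open string: the pairs `(s, t)` of parameters of an uncircled double point such
that the curve near `s` crosses the curve near `t` from left to right. -/
def arrowSet (α : OpenString) : Set (ℝ × ℝ) :=
  {e | e.1 ≠ e.2 ∧ α.curve e.1 = α.curve e.2 ∧ α.curve e.1 ∉ α.circled ∧
    0 < planeDet (deriv α.curve e.1) (deriv α.curve e.2)}

theorem finite_arrowSet (α : OpenString) : α.arrowSet.Finite :=
  (α.finite.prod α.finite).subset fun e he =>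
    ⟨⟨e.2, he.1.symm, he.2.1.symm⟩, ⟨e.1, he.1, he.2.1⟩⟩

/-- The Gauss diagram of an open string. -/
def gauss (α : OpenString) : GaussDiagram where
  arrows := α.finite_arrowSet.toFinset
  ne e he := ((Set.Finite.mem_toFinset _).1 he).1
  disjoint e he e' he' hne := by
    rw [Set.Finite.mem_toFinset] at he he'
    obtain ⟨s, t⟩ := e
    obtain ⟨s', t'⟩ := e'
    obtain ⟨h1, h2, -, h3⟩ := he
    obtain ⟨h1', h2', -, h3'⟩ := he'
    dsimp only at *
    refine ⟨?_, ?_, ?_, ?_⟩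
    · rintro rfl
      rcases α.no_triple t s t' h2.symm h2' with h | h | h
      exacts [h1 h.symm, h1' h, hne (by rw [h])]
    · rintro rfl
      rcases α.no_triple t s s' h2.symm h2'.symm with h | h | h
      · exact h1 h.symm
      · exact h1' h.symm
      · subst h
        simp only [planeDet] at h3 h3'
        linarith
    · rintro rfl
      rcases α.no_triple s t t' h2 h2' with h | h | h
      · exact h1 h
      · exact h1' h
      · subst h
        simp only [planeDet] at h3 h3'
        linarith
    · rintro rfl
      rcases α.no_triple s t s' h2 h2'.symm with h | h | h
      exacts [h1 h, h1' h.symm, hne (by rw [h])]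

/-- Two open strings are regarded as the same if their Gauss diagrams are homotopic. -/
def Same (α β : OpenString) : Prop := α.gauss.Homotopic β.gauss

/-- An open string is classical if it has no circled double points. -/
def IsClassical (α : OpenString) : Prop := α.circled = ∅

/-- The endomorphism `Φ(α)` of the free group `F` on `a_n`, `n ∈ ℤ²`. -/
def Phi (α : OpenString) : FreeGroup (ℤ × ℤ) →* FreeGroup (ℤ × ℤ) := α.gauss.Phi

end OpenString

end

/-!
There are two parts: `Φ` is an invariant of homotopy of Gauss diagrams, and `Φ` is trivial on
classical open strings.

*Invariance.* A homomorphism from the extended Alexander group is a coloring of the arcs that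
satisfies the crossing relations, so `Φ(D)` is read off the right end of the unique coloring by
words that is tautological on the left end (`transports_phi`, `Transports.eq_phi`). A move changes
the diagram inside a few intervals of the line without distinguished points of the rest of the
diagram. A coloring before the move becomes a coloring after it if only the labels inside these
intervals are changed (`Transports.move`). That suitable new labels exist is a computation in a
group with two commuting automorphisms, the translations by `u` and `v` (`CrossingRel.cyclic` and
its companions).

*Classical open strings.* Only the relation `a_n b_{n+u} = c_n d_{n+u}` is needed. The index shift
is absorbed by replacing the family `x` by a permutation of `ℤ² × A` (`familyPerm`), so that the
relation reads `a b = c d`. Label the faces of the curve, that is, the components of its complement,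
by group elements such that the label is multiplied on the left by `x` when the arc `x` is crossed
from left to right. Around a double point this is consistent by the relation, as all double points
are arrows when none is circled (`exists_isSolAt_of_crossing`). As the plane is simply connected,
the local labelings glue to one on an arbitrarily large rectangle (`exists_isSolOn_rectangle`). The
faces on the left of both ends of the curve are the same, and so are the faces on the right; hence
both ends have the same label (`IsArcLabeling.eventually_eq`), and `(a_{+∞})_n = (a_{-∞})_n`.

The gluing uses that two solutions differ by a constant, because their quotient does not jump across
the curve and a rectangle minus the double points is connected. So nothing has to be required at the
double points themselves once local solutions exist there.
-/

section

open Set Filter Topology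

/-! ### Labels at a crossing -/

/-- The relations at a flat crossing, for labels in a group `V` with automorphisms `σ` and `τ`. The
first strand crosses the second from left to right; its label changes from `s` to `s'`, that of the
second strand from `t` to `t'`. The proposition `p` says that the first strand is visited before the
second, that is, that the crossing of the descending diagram is positive. -/
structure CrossingRel {V : Type*} [Group V] (σ τ : V ≃* V) (p : Prop) (s t s' t' : V) : Prop where
  crossing : t * σ s = s' * σ t'
  pos : p → τ s' = s
  neg : ¬ p → τ t = t'

section CrossingRel

variable {V : Type*} [Group V] {σ τ : V ≃* V} {p q r : Prop}

theorem crossingRel_iff_of_pos (hp : p) {s t s' t' : V} : CrossingRel σ τ p s t s' t' ↔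
    s' = τ.symm s ∧ t' = σ.symm ((τ.symm s)⁻¹ * t) * s := by
  constructor
  · rintro ⟨h, h', -⟩
    obtain rfl := h' hp
    refine ⟨by simp, ?_⟩
    apply σ.injective
    simp [mul_assoc, h]
  · rintro ⟨rfl, rfl⟩
    exact ⟨by simp [mul_assoc], by simp, fun h => absurd hp h⟩

theorem crossingRel_iff_of_neg (hp : ¬ p) {s t s' t' : V} : CrossingRel σ τ p s t s' t' ↔
    t' = τ t ∧ s' = t * σ (s * (τ t)⁻¹) := by
  constructor
  · rintro ⟨h, -, h'⟩
    obtain rfl := h' hp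
    refine ⟨rfl, ?_⟩
    rw [map_mul, ← mul_assoc, h]
    simp
  · rintro ⟨rfl, rfl⟩
    exact ⟨by simp [mul_assoc], fun h => absurd h hp, fun _ => rfl⟩

theorem symm_comm_of_comm (h : ∀ x, τ (σ x) = σ (τ x)) : (∀ x, τ.symm (σ x) = σ (τ.symm x)) ∧
    (∀ x, τ (σ.symm x) = σ.symm (τ x)) ∧ (∀ x, τ.symm (σ.symm x) = σ.symm (τ.symm x)) := by
  have h1 : ∀ x, τ.symm (σ x) = σ (τ.symm x) := fun x => by
    apply τ.injective
    simp [h]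
  refine ⟨h1, fun x => ?_, fun x => ?_⟩
  · apply σ.injective
    simp [← h]
  · apply σ.injective
    simp [← h1]

/-- The first move: a kink, the second passage of which follows directly after the first. -/
theorem exists_crossingRel_self (x : V) (p : Prop) :
    (∃ y, CrossingRel σ τ p x y y x) ∧ ∃ y, CrossingRel σ τ p y x x y := by
  by_cases hp : p
  · simp only [crossingRel_iff_of_pos hp]
    exact ⟨⟨_, rfl, by simp⟩, τ x, by simp, by simp⟩
  · simp only [crossingRel_iff_of_neg hp]
    exact ⟨⟨τ.symm x, by simp, by simp⟩, _, rfl, by simp⟩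

/-- The second move, for parallel strands. -/
theorem CrossingRel.exists_parallel (hq : q ↔ ¬ p) (a b : V) :
    ∃ a' b', CrossingRel σ τ p a b a' b' ∧ CrossingRel σ τ q b' a' b a := by
  by_cases hp : p
  · simp [crossingRel_iff_of_pos hp, crossingRel_iff_of_neg (show ¬ q by tauto), mul_assoc]
  · simp [crossingRel_iff_of_neg hp, crossingRel_iff_of_pos (show q by tauto), mul_assoc]

/-- The second move, for antiparallel strands the first of which crosses the other from left to
right at its first crossing. -/
theorem CrossingRel.exists_antiparallel (hq : q ↔ ¬ p) (a b : V) :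
    ∃ a' b', CrossingRel σ τ p a b' a' b ∧ CrossingRel σ τ q b a' b' a := by
  by_cases hp : p
  · simp only [crossingRel_iff_of_pos hp, crossingRel_iff_of_neg (show ¬ q by tauto)]
    exact ⟨τ.symm a, _, ⟨rfl, by simp [mul_assoc]⟩, by simp, rfl⟩
  · simp only [crossingRel_iff_of_neg hp, crossingRel_iff_of_pos (show q by tauto)]
    exact ⟨_, τ.symm b, ⟨by simp, rfl⟩, rfl, by simp [mul_assoc]⟩

/-- The second move, for antiparallel strands the first of which crosses the other from right to
left at its first crossing. -/
theorem CrossingRel.exists_antiparallel' (hq : q ↔ ¬ p) (a b : V) :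
    ∃ a' b', CrossingRel σ τ p b' a b a' ∧ CrossingRel σ τ q a' b a b' := by
  by_cases hp : p
  · simp only [crossingRel_iff_of_pos hp, crossingRel_iff_of_neg (show ¬ q by tauto)]
    exact ⟨_, τ b, ⟨by simp, rfl⟩, rfl, by simp [mul_assoc]⟩
  · simp only [crossingRel_iff_of_neg hp, crossingRel_iff_of_pos (show q by tauto)]
    exact ⟨τ a, _, ⟨rfl, by simp [mul_assoc]⟩, by simp, rfl⟩

theorem CrossingRel.cyclic_aux (h : ∀ x, τ (σ x) = σ (τ x)) {a₀ a₁ a₂ b₀ b₁ b₂ c₀ c₁ c₂ : V}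
    (hp : p) (hr : ¬ r) (hab : CrossingRel σ τ p a₁ b₀ a₂ b₁)
    (hbc : CrossingRel σ τ q b₁ c₀ b₂ c₁) (hca : CrossingRel σ τ r c₁ a₀ c₂ a₁) :
    ∃ a b c, CrossingRel σ τ p a₀ b a b₂ ∧ CrossingRel σ τ q b₀ c b c₂ ∧
      CrossingRel σ τ r c₀ a c a₂ := by
  obtain ⟨-, -, h3⟩ := symm_comm_of_comm h
  by_cases hq : q
  all_goals
    simp only [crossingRel_iff_of_pos hp, crossingRel_iff_of_neg hr] at hab hca ⊢
    first
      | simp only [crossingRel_iff_of_pos hq] at hbc ⊢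
      | simp only [crossingRel_iff_of_neg hq] at hbc ⊢
    obtain ⟨rfl, rfl⟩ := hab
    obtain ⟨rfl, rfl⟩ := hbc
    obtain ⟨rfl, rfl⟩ := hca
    refine ⟨τ.symm a₀, ?_⟩
  · refine ⟨_, _, ⟨rfl, ?_⟩, ⟨rfl, ?_⟩, ?_, rfl⟩ <;> simp [mul_assoc, h3]
  · refine ⟨_, _, ⟨rfl, ?_⟩, ⟨?_, rfl⟩, ?_, rfl⟩ <;> simp [mul_assoc, h]

/-- The third move, for strands that cross one another cyclically from left to right. The
hypotheses `hn` and `hn'` say that the strands are visited in some linear order. -/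
theorem CrossingRel.cyclic (h : ∀ x, τ (σ x) = σ (τ x)) {a₀ a₁ a₂ b₀ b₁ b₂ c₀ c₁ c₂ : V}
    (hn : ¬ (p ∧ q ∧ r)) (hn' : p ∨ q ∨ r) (hab : CrossingRel σ τ p a₁ b₀ a₂ b₁)
    (hbc : CrossingRel σ τ q b₁ c₀ b₂ c₁) (hca : CrossingRel σ τ r c₁ a₀ c₂ a₁) :
    ∃ a b c, CrossingRel σ τ p a₀ b a b₂ ∧ CrossingRel σ τ q b₀ c b c₂ ∧
      CrossingRel σ τ r c₀ a c a₂ := by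
  -- the situation is invariant under rotation; rotate until `p` holds and `r` does not
  by_cases hp : p
  · by_cases hr : r
    · obtain ⟨c, a, b, h1, h2, h3⟩ := cyclic_aux h hr (by tauto) hca hab hbc
      exact ⟨a, b, c, h2, h3, h1⟩
    · exact cyclic_aux h hp hr hab hbc hca
  · by_cases hq : q
    · obtain ⟨b, c, a, h1, h2, h3⟩ := cyclic_aux h hq hp hbc hca hab
      exact ⟨a, b, c, h3, h1, h2⟩
    · obtain ⟨c, a, b, h1, h2, h3⟩ := cyclic_aux h (by tauto) hq hca hab hbc
      exact ⟨a, b, c, h2, h3, h1⟩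

/-- The third move, for strands that cross one another transitively from left to right. The
hypotheses `hn` and `hn'` say that the strands are visited in some linear order. -/
theorem CrossingRel.transitive (h : ∀ x, τ (σ x) = σ (τ x)) {a₀ a₁ a₂ b₀ b₁ b₂ c₀ c₁ c₂ : V}
    (hn : p → r → q) (hn' : q → p ∨ r) (hab : CrossingRel σ τ p a₀ b₀ a₁ b₁)
    (hac : CrossingRel σ τ q a₁ c₀ a₂ c₁) (hbc : CrossingRel σ τ r b₁ c₁ b₂ c₂) :
    ∃ a b c, CrossingRel σ τ p a b a₂ b₂ ∧ CrossingRel σ τ q a₀ c a c₂ ∧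
      CrossingRel σ τ r b₀ c₀ b c := by
  obtain ⟨h1, h2, h3⟩ := symm_comm_of_comm h
  by_cases hp : p <;> by_cases hq : q <;> by_cases hr : r
  all_goals first | (exfalso; tauto) | skip
  all_goals
    first
      | simp only [crossingRel_iff_of_pos hp] at hab ⊢
      | simp only [crossingRel_iff_of_neg hp] at hab ⊢
    first
      | simp only [crossingRel_iff_of_pos hq] at hac ⊢
      | simp only [crossingRel_iff_of_neg hq] at hac ⊢
    first
      | simp only [crossingRel_iff_of_pos hr] at hbc ⊢
      | simp only [crossingRel_iff_of_neg hr] at hbc ⊢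
    obtain ⟨rfl, rfl⟩ := hab
    obtain ⟨rfl, rfl⟩ := hac
    obtain ⟨rfl, rfl⟩ := hbc
    first
      | refine ⟨_, _, _, ⟨?_, ?_⟩, ⟨rfl, ?_⟩, rfl, rfl⟩
      | refine ⟨_, _, _, ⟨?_, ?_⟩, ⟨?_, rfl⟩, rfl, rfl⟩
  all_goals simp [mul_assoc, h, h1, h2, h3]

end CrossingRel

/-! ### Labelings of the line -/

section Labeling

variable {V : Type*}

/-- A labeling of the intervals into which the points of `P` cut the line. It is encoded by two
functions: `L x` is the label just before `x`, and `R x` the label just after `x`. -/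
structure IsLabeling (P : Set ℝ) (L R : ℝ → V) : Prop where
  cont : ∀ x y, x < y → Disjoint P (Ioo x y) → R x = L y
  reg : ∀ x ∉ P, L x = R x

theorem IsLabeling.mono {P Q : Set ℝ} {L R : ℝ → V} (h : IsLabeling P L R) (hPQ : P ⊆ Q) :
    IsLabeling Q L R :=
  ⟨fun x y hxy h' => h.cont x y hxy (h'.mono_left hPQ), fun x hx => h.reg x fun h' => hx (hPQ h')⟩

/-- The interval from `a` to `a'` can be relabeled by `y`, at the cost of cutting at its ends. -/
theorem IsLabeling.exists_override {P : Set ℝ} {L R : ℝ → V} (h : IsLabeling P L R) {a a' : ℝ}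
    (ha : a < a') (y : V) :
    ∃ L' R' : ℝ → V, IsLabeling (P ∪ {a, a'}) L' R' ∧ L' a = L a ∧ R' a = y ∧ L' a' = y ∧
      R' a' = R a' ∧ ∀ z ∉ Icc a a', L' z = L z ∧ R' z = R z := by
  classical
  refine ⟨(Ioc a a').piecewise (fun _ => y) L, (Ico a a').piecewise (fun _ => y) R,
    ⟨fun x z hxz hP => ?_, fun x hx => ?_⟩, by simp [Set.piecewise], by simp [Set.piecewise, ha],
    by simp [Set.piecewise, ha], by simp [Set.piecewise], fun z hz => ⟨?_, ?_⟩⟩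
  · rw [disjoint_union_left] at hP
    have h1 : a ∉ Ioo x z := fun h' => disjoint_left.1 hP.2 (by simp) h'
    have h2 : a' ∉ Ioo x z := fun h' => disjoint_left.1 hP.2 (by simp) h'
    have h3 : x ∈ Ico a a' ↔ z ∈ Ioc a a' := by
      simp only [mem_Ioo, not_and, not_lt, mem_Ico, mem_Ioc] at *
      constructor
      · rintro ⟨h4, h5⟩
        exact ⟨lt_of_le_of_lt h4 hxz, h2 h5⟩
      · rintro ⟨h4, h5⟩
        exact ⟨not_lt.1 fun h6 => absurd (h1 h6) (not_le.2 h4), lt_of_lt_of_le hxz h5⟩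
    by_cases hx : x ∈ Ico a a'
    · rw [piecewise_eq_of_mem _ _ _ hx, piecewise_eq_of_mem _ _ _ (h3.1 hx)]
    · rw [piecewise_eq_of_notMem _ _ _ hx, piecewise_eq_of_notMem _ _ _ (mt h3.2 hx)]
      exact h.cont x z hxz hP.1
  · simp only [mem_union, mem_insert_iff, mem_singleton_iff, not_or] at hx
    have h3 : x ∈ Ioc a a' ↔ x ∈ Ico a a' := by
      simp only [mem_Ico, mem_Ioc, le_iff_lt_or_eq, hx.2.2, Ne.symm hx.2.1, or_false]
    by_cases hx' : x ∈ Ico a a'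
    · rw [piecewise_eq_of_mem _ _ _ hx', piecewise_eq_of_mem _ _ _ (h3.2 hx')]
    · rw [piecewise_eq_of_notMem _ _ _ hx', piecewise_eq_of_notMem _ _ _ (mt h3.1 hx')]
      exact h.reg x hx.1
  · exact piecewise_eq_of_notMem _ _ _ fun h' => hz (Ioc_subset_Icc_self h')
  · exact piecewise_eq_of_notMem _ _ _ fun h' => hz (Ico_subset_Icc_self h')

/-- On an interval without points the label is constant. -/
theorem IsLabeling.eq_of_disjoint {P : Set ℝ} {L R : ℝ → V} (h : IsLabeling P L R) {a a' : ℝ}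
    (ha : a < a') (hd : Disjoint P (Icc a a')) : R a' = L a := by
  rw [h.reg a fun h' => disjoint_left.1 hd h' (left_mem_Icc.2 ha.le),
    ← h.reg a' fun h' => disjoint_left.1 hd h' (right_mem_Icc.2 ha.le),
    h.cont a a' ha (hd.mono_right Ioo_subset_Icc_self)]

theorem eventually_eq_of_forall_notMem_Icc {L L' : ℝ → V} {a a' : ℝ}
    (h : ∀ z ∉ Icc a a', L' z = L z) : L' =ᶠ[atBot] L ∧ L' =ᶠ[atTop] L :=
  ⟨(eventually_lt_atBot a).mono fun z hz => h z fun h' => absurd h'.1 (not_le.2 hz),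
    (eventually_gt_atTop a').mono fun z hz => h z fun h' => absurd h'.2 (not_le.2 hz)⟩

end Labeling

/-! ### Colorings of Gauss diagrams and their invariance -/

namespace GaussDiagram

/-- There is a coloring of the arcs of `D` by elements of `V` that satisfies the crossing relations
and that is `l` on the left end and `r` on the right end. -/
def Transports {V : Type*} [Group V] (D : GaussDiagram) (σ τ : V ≃* V) (l r : V) : Prop :=
  ∃ L R : ℝ → V, IsLabeling (D.points : Set ℝ) L R ∧
    (∀ s t, (s, t) ∈ D.arrows → CrossingRel σ τ (s < t) (L s) (L t) (R s) (R t)) ∧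
    (∀ᶠ x in atBot, L x = l) ∧ ∀ᶠ x in atTop, L x = r

/-- Two disjoint intervals are ordered like any of their points. -/
theorem lt_iff_of_disjoint_Icc {a a' b b' x y z w : ℝ} (h : Disjoint (Icc a a') (Icc b b'))
    (hx : x ∈ Icc a a') (hy : y ∈ Icc b b') (hz : z ∈ Icc a a') (hw : w ∈ Icc b b') :
    (x < y ↔ z < w) ∧ (y < x ↔ ¬ z < w) := by
  have key : a' < b ∨ b' < a := by
    by_contra! h'
    have h1 := hx.1.trans hx.2
    have h2 := hy.1.trans hy.2
    exact disjoint_left.1 h (show max a b ∈ _ from ⟨le_max_left _ _, max_le h1 h'.1⟩)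
      ⟨le_max_right _ _, max_le h'.2 h2⟩
  obtain ⟨hx1, hx2⟩ := hx
  obtain ⟨hy1, hy2⟩ := hy
  obtain ⟨hz1, hz2⟩ := hz
  obtain ⟨hw1, hw2⟩ := hw
  rcases key with k | k
  · exact ⟨iff_of_true (by linarith) (by linarith),
      iff_of_false (by linarith) (not_not.2 (by linarith))⟩
  · exact ⟨iff_of_false (by linarith) (by linarith), iff_of_true (by linarith) (by linarith)⟩

theorem FreeOn.disjoint {D : GaussDiagram} {I J : Set ℝ} (h : D.FreeOn I) (hJ : J ⊆ I) :
    Disjoint (D.points : Set ℝ) J :=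
  disjoint_left.2 fun x hx hx' => h x hx (hJ hx')

theorem points_subset_of_arrows {D D' : GaussDiagram} (h : D.arrows ⊆ D'.arrows) :
    (D.points : Set ℝ) ⊆ D'.points := by
  intro x hx
  obtain ⟨e, he, he'⟩ := mem_points.1 hx
  exact mem_points.2 ⟨e, h he, he'⟩

variable {V : Type*} [Group V] {σ τ : V ≃* V} {l r : V}

theorem Transports.reparam {D D' : GaussDiagram} (hD : D.Transports σ τ l r) (φ : ℝ ≃o ℝ)
    (h : D'.arrows = D.arrows.image (Prod.map φ φ)) : D'.Transports σ τ l r := by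
  obtain ⟨L, R, hLR, hrel, hl, hr⟩ := hD
  have hp : ∀ x, φ x ∈ D'.points ↔ x ∈ D.points := fun x => by
    simp [mem_points, h]
  refine ⟨L ∘ φ.symm, R ∘ φ.symm, ⟨fun x y hxy hd => ?_, fun x hx => ?_⟩, fun s t hst => ?_,
    φ.symm.tendsto_atBot.eventually hl, φ.symm.tendsto_atTop.eventually hr⟩
  · refine hLR.cont _ _ (φ.symm.lt_iff_lt.2 hxy) (disjoint_left.2 fun z hz hz' => ?_)
    exact disjoint_left.1 hd (Finset.mem_coe.2 ((hp z).2 (Finset.mem_coe.1 hz)))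
      ⟨by rw [← φ.symm_apply_lt]; exact hz'.1, by rw [← φ.lt_symm_apply]; exact hz'.2⟩
  · exact hLR.reg _ fun hx' => hx (by simpa using (hp _).2 (Finset.mem_coe.1 hx'))
  · rw [h, Finset.mem_image] at hst
    obtain ⟨⟨s', t'⟩, he, hst⟩ := hst
    obtain ⟨rfl, rfl⟩ := Prod.mk.inj hst
    simpa using hrel s' t' he

theorem Transports.one {D D' : GaussDiagram} (hD : D.Transports σ τ l r) (s t : ℝ)
    (free : D.FreeOn (Set.uIcc s t)) (h : D'.arrows = D.arrows ∪ {(s, t)}) :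
    D'.Transports σ τ l r := by
  obtain ⟨L, R, hLR, hrel, hl, hr⟩ := hD
  have hst : (s, t) ∈ D'.arrows := by simp [h]
  have hsub : (D.points : Set ℝ) ⊆ D'.points := points_subset_of_arrows (by simp [h])
  have hs : s ∈ D'.points := fst_mem hst
  have ht : t ∈ D'.points := snd_mem hst
  have hfree := free.disjoint subset_rfl
  -- the arc between `s` and `t` gets the label `y`
  have key : ∀ a a', a < a' → Icc a a' = uIcc s t → ∀ y : V, ∃ L' R' : ℝ → V,
      IsLabeling (D.points ∪ {a, a'}) L' R' ∧ L' a = L a ∧ R' a = y ∧ L' a' = y ∧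
      R' a' = L a ∧ (∀ᶠ x in atBot, L' x = l) ∧ (∀ᶠ x in atTop, L' x = r) ∧
      ∀ s' t', (s', t') ∈ D.arrows → CrossingRel σ τ (s' < t') (L' s') (L' t') (R' s') (R' t') := by
    intro a a' ha hu y
    rw [← hu] at hfree
    obtain ⟨L', R', h', h1, h2, h3, h4, h5⟩ :=
      hLR.exists_override ha y
    obtain ⟨e1, e2⟩ := eventually_eq_of_forall_notMem_Icc fun z hz => (h5 z hz).1
    refine ⟨L', R', h', h1, h2, h3, h4.trans (hLR.eq_of_disjoint ha hfree), e1.trans hl,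
      e2.trans hr, fun s' t' he => ?_⟩
    have hs' := disjoint_left.1 hfree (Finset.mem_coe.2 (fst_mem he))
    have ht' := disjoint_left.1 hfree (Finset.mem_coe.2 (snd_mem he))
    rw [(h5 _ hs').1, (h5 _ hs').2, (h5 _ ht').1, (h5 _ ht').2]
    exact hrel s' t' he
  rcases lt_or_gt_of_ne (D'.ne _ hst) with hlt | hlt <;> dsimp only at hlt
  · obtain ⟨y, hy⟩ := (exists_crossingRel_self (σ := σ) (τ := τ) (L s) (s < t)).1
    obtain ⟨L', R', h', h1, h2, h3, h4, e1, e2, hrel'⟩ := key s t hlt (uIcc_of_lt hlt).symm y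
    refine ⟨L', R', h'.mono (union_subset hsub ?_), fun s' t' he => ?_, e1, e2⟩
    · rintro x (rfl | rfl)
      exacts [hs, ht]
    · rw [h, Finset.mem_union, Finset.mem_singleton] at he
      rcases he with he | he
      · exact hrel' s' t' he
      · obtain ⟨rfl, rfl⟩ := Prod.mk.inj he
        rwa [h1, h2, h3, h4]
  · obtain ⟨y, hy⟩ := (exists_crossingRel_self (σ := σ) (τ := τ) (L t) (s < t)).2
    obtain ⟨L', R', h', h1, h2, h3, h4, e1, e2, hrel'⟩ := key t s hlt (uIcc_of_gt hlt).symm y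
    refine ⟨L', R', h'.mono (union_subset hsub ?_), fun s' t' he => ?_, e1, e2⟩
    · rintro x (rfl | rfl)
      exacts [ht, hs]
    · rw [h, Finset.mem_union, Finset.mem_singleton] at he
      rcases he with he | he
      · exact hrel' s' t' he
      · obtain ⟨rfl, rfl⟩ := Prod.mk.inj he
        rwa [h1, h2, h3, h4]

theorem Transports.two {D D' : GaussDiagram} (hD : D.Transports σ τ l r) {a a' b b' : ℝ}
    (ha : a < a') (hb : b < b') (disj : Disjoint (Set.Icc a a') (Set.Icc b b'))
    (free : D.FreeOn (Set.Icc a a' ∪ Set.Icc b b'))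
    (h : D'.arrows = D.arrows ∪ {(a, b), (b', a')} ∨
      D'.arrows = D.arrows ∪ {(a, b'), (b, a')} ∨
      D'.arrows = D.arrows ∪ {(b', a), (a', b)}) : D'.Transports σ τ l r := by
  obtain ⟨L, R, hLR, hrel, hl, hr⟩ := hD
  have hfa := free.disjoint subset_union_left
  have hfb := free.disjoint subset_union_right
  have ha1 : a ∈ Icc a a' := left_mem_Icc.2 ha.le
  have ha2 : a' ∈ Icc a a' := right_mem_Icc.2 ha.le
  have hb1 : b ∈ Icc b b' := left_mem_Icc.2 hb.le
  have hb2 : b' ∈ Icc b b' := right_mem_Icc.2 hb.le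
  have na1 := disjoint_left.1 disj ha1
  have na2 := disjoint_left.1 disj ha2
  have nb1 := disjoint_right.1 disj hb1
  have nb2 := disjoint_right.1 disj hb2
  -- the arcs between `a` and `a'` and between `b` and `b'` get the labels `x` and `y`
  have key : ∀ x y : V, ∃ L' R' : ℝ → V,
      IsLabeling (D.points ∪ {a, a'} ∪ {b, b'}) L' R' ∧
      (L' a = L a ∧ R' a = x ∧ L' a' = x ∧ R' a' = L a) ∧
      (L' b = L b ∧ R' b = y ∧ L' b' = y ∧ R' b' = L b) ∧
      (∀ᶠ x in atBot, L' x = l) ∧ (∀ᶠ x in atTop, L' x = r) ∧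
      ∀ s' t', (s', t') ∈ D.arrows →
        CrossingRel σ τ (s' < t') (L' s') (L' t') (R' s') (R' t') := by
    intro x y
    obtain ⟨L₁, R₁, h', h1, h2, h3, h4, h5⟩ :=
      hLR.exists_override ha x
    obtain ⟨L₂, R₂, k', k1, k2, k3, k4, k5⟩ := h'.exists_override hb y
    obtain ⟨e1, e2⟩ := eventually_eq_of_forall_notMem_Icc fun z hz => (h5 z hz).1
    obtain ⟨e3, e4⟩ := eventually_eq_of_forall_notMem_Icc fun z hz => (k5 z hz).1
    refine ⟨L₂, R₂, k', ⟨(k5 _ na1).1.trans h1, (k5 _ na1).2.trans h2, (k5 _ na2).1.trans h3,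
      (k5 _ na2).2.trans (h4.trans (hLR.eq_of_disjoint ha hfa))⟩, ⟨k1.trans (h5 _ nb1).1, k2, k3,
      k4.trans ((h5 _ nb2).2.trans (hLR.eq_of_disjoint hb hfb))⟩, e3.trans (e1.trans hl),
      e4.trans (e2.trans hr), fun s t he => ?_⟩
    have hs' := disjoint_left.1 hfa (Finset.mem_coe.2 (fst_mem he))
    have ht' := disjoint_left.1 hfa (Finset.mem_coe.2 (snd_mem he))
    have hs'' := disjoint_left.1 hfb (Finset.mem_coe.2 (fst_mem he))
    have ht'' := disjoint_left.1 hfb (Finset.mem_coe.2 (snd_mem he))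
    rw [(k5 _ hs'').1, (k5 _ hs'').2, (k5 _ ht'').1, (k5 _ ht'').2,
      (h5 _ hs').1, (h5 _ hs').2, (h5 _ ht').1, (h5 _ ht').2]
    exact hrel s t he
  have hp : ∀ {c c' d d' e e' : ℝ}, D'.arrows = D.arrows ∪ {(c, c'), (d, d')} →
      e ∈ ({c, c', d, d'} : Set ℝ) → e' ∈ ({c, c', d, d'} : Set ℝ) →
      ({e, e'} : Set ℝ) ⊆ D'.points := by
    intro c c' d d' e e' h he he'
    have h1 : (c, c') ∈ D'.arrows := by simp [h]
    have h2 : (d, d') ∈ D'.arrows := by simp [h]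
    have h3 : ({c, c', d, d'} : Set ℝ) ⊆ D'.points := by
      rintro x (rfl | rfl | rfl | rfl)
      exacts [fst_mem h1, snd_mem h1, fst_mem h2, snd_mem h2]
    rintro x (rfl | rfl)
    exacts [h3 he, h3 he']
  rcases h with h | h | h
  · obtain ⟨x, y, hxy, hyx⟩ := CrossingRel.exists_parallel (σ := σ) (τ := τ)
      (p := a < b) (q := b' < a') (lt_iff_of_disjoint_Icc disj ha2 hb2 ha1 hb1).2 (L a) (L b)
    obtain ⟨L', R', h', ⟨h1, h2, h3, h4⟩, ⟨k1, k2, k3, k4⟩, e1, e2, hrel'⟩ := key x y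
    refine ⟨L', R', h'.mono (union_subset (union_subset (points_subset_of_arrows
      (h ▸ Finset.subset_union_left)) (hp h (by simp) (by simp)))
      (hp h (by simp) (by simp))), fun s t he => ?_, e1, e2⟩
    simp only [h, Finset.mem_union, Finset.mem_insert, Finset.mem_singleton, Prod.mk.injEq] at he
    rcases he with he | ⟨rfl, rfl⟩ | ⟨rfl, rfl⟩
    · exact hrel' s t he
    · rwa [h1, h2, k1, k2]
    · rwa [h3, h4, k3, k4]
  · obtain ⟨x, y, hxy, hyx⟩ := CrossingRel.exists_antiparallel (σ := σ) (τ := τ)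
      (p := a < b') (q := b < a') (lt_iff_of_disjoint_Icc disj ha2 hb1 ha1 hb2).2 (L a) (L b)
    obtain ⟨L', R', h', ⟨h1, h2, h3, h4⟩, ⟨k1, k2, k3, k4⟩, e1, e2, hrel'⟩ := key x y
    refine ⟨L', R', h'.mono (union_subset (union_subset (points_subset_of_arrows
      (h ▸ Finset.subset_union_left)) (hp h (by simp) (by simp)))
      (hp h (by simp) (by simp))), fun s t he => ?_, e1, e2⟩
    simp only [h, Finset.mem_union, Finset.mem_insert, Finset.mem_singleton, Prod.mk.injEq] at he
    rcases he with he | ⟨rfl, rfl⟩ | ⟨rfl, rfl⟩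
    · exact hrel' s t he
    · rwa [h1, h2, k3, k4]
    · rwa [h3, h4, k1, k2]
  · obtain ⟨x, y, hxy, hyx⟩ := CrossingRel.exists_antiparallel' (σ := σ) (τ := τ)
      (p := b' < a) (q := a' < b) (lt_iff_of_disjoint_Icc disj.symm hb1 ha2 hb2 ha1).2 (L a) (L b)
    obtain ⟨L', R', h', ⟨h1, h2, h3, h4⟩, ⟨k1, k2, k3, k4⟩, e1, e2, hrel'⟩ := key x y
    refine ⟨L', R', h'.mono (union_subset (union_subset (points_subset_of_arrows
      (h ▸ Finset.subset_union_left)) (hp h (by simp) (by simp)))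
      (hp h (by simp) (by simp))), fun s t he => ?_, e1, e2⟩
    simp only [h, Finset.mem_union, Finset.mem_insert, Finset.mem_singleton, Prod.mk.injEq] at he
    rcases he with he | ⟨rfl, rfl⟩ | ⟨rfl, rfl⟩
    · exact hrel' s t he
    · rwa [h1, h2, k3, k4]
    · rwa [h3, h4, k1, k2]

end GaussDiagram

namespace GaussDiagram

variable {V : Type*} [Group V] {σ τ : V ≃* V} {l r : V}

theorem mem_points_of_arrows_eq_union {D D' : GaussDiagram} {S : Finset (ℝ × ℝ)}
    (h : D'.arrows = D.arrows ∪ S) {x : ℝ} :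
    x ∈ D'.points ↔ x ∈ D.points ∨ ∃ e ∈ S, x = e.1 ∨ x = e.2 := by
  simp only [mem_points, h, Finset.mem_union, or_and_right, exists_or]

theorem Transports.three {D₀ D D' : GaussDiagram} (hστ : ∀ x, τ (σ x) = σ (τ x))
    (hD : D.Transports σ τ l r) {a a' b b' c c' : ℝ}
    (ha : a < a') (hb : b < b') (hc : c < c')
    (hab : Disjoint (Set.Icc a a') (Set.Icc b b'))
    (hbc : Disjoint (Set.Icc b b') (Set.Icc c c'))
    (hac : Disjoint (Set.Icc a a') (Set.Icc c c'))
    (free : D₀.FreeOn (Set.Icc a a' ∪ Set.Icc b b' ∪ Set.Icc c c'))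
    (h : (D.arrows = D₀.arrows ∪ {(a', b), (b', c), (c', a)} ∧
        D'.arrows = D₀.arrows ∪ {(a, b'), (b, c'), (c, a')}) ∨
      (D.arrows = D₀.arrows ∪ {(a, b), (a', c), (b', c')} ∧
        D'.arrows = D₀.arrows ∪ {(a', b'), (a, c'), (b, c)})) : D'.Transports σ τ l r := by
  obtain ⟨L, R, hLR, hrel, hl, hr⟩ := hD
  have hfa := free.disjoint (subset_union_left.trans subset_union_left)
  have hfb := free.disjoint (subset_union_right.trans subset_union_left)
  have hfc := free.disjoint subset_union_right
  have ha1 : a ∈ Icc a a' := left_mem_Icc.2 ha.le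
  have ha2 : a' ∈ Icc a a' := right_mem_Icc.2 ha.le
  have hb1 : b ∈ Icc b b' := left_mem_Icc.2 hb.le
  have hb2 : b' ∈ Icc b b' := right_mem_Icc.2 hb.le
  have hc1 : c ∈ Icc c c' := left_mem_Icc.2 hc.le
  have hc2 : c' ∈ Icc c c' := right_mem_Icc.2 hc.le
  have hp : ∀ {E : GaussDiagram}, (E.arrows = D₀.arrows ∪ {(a', b), (b', c), (c', a)} ∨
      E.arrows = D₀.arrows ∪ {(a, b'), (b, c'), (c, a')} ∨
      E.arrows = D₀.arrows ∪ {(a, b), (a', c), (b', c')} ∨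
      E.arrows = D₀.arrows ∪ {(a', b'), (a, c'), (b, c)}) →
      (E.points : Set ℝ) = (D₀.points : Set ℝ) ∪ {a, a', b, b', c, c'} := by
    intro E hE
    ext x
    simp only [mem_union, Finset.mem_coe, mem_insert_iff, mem_singleton_iff]
    rcases hE with hE | hE | hE | hE <;> rw [mem_points_of_arrows_eq_union hE] <;>
    simp only [Finset.mem_insert, Finset.mem_singleton, or_and_right, exists_or,
      exists_eq_left] <;> exact iff_of_eq (by ac_rfl)
  have hPD : (D.points : Set ℝ) = (D₀.points : Set ℝ) ∪ {a, a', b, b', c, c'} := hp (by tauto)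
  have hPD' : (D'.points : Set ℝ) = (D₀.points : Set ℝ) ∪ {a, a', b, b', c, c'} := hp (by tauto)
  have hsix : Disjoint ({a, a', b, b', c, c'} : Set ℝ) (Ioo a a') ∧
      Disjoint ({a, a', b, b', c, c'} : Set ℝ) (Ioo b b') ∧
      Disjoint ({a, a', b, b', c, c'} : Set ℝ) (Ioo c c') := by
    have sub : ∀ {x y z : ℝ}, z ∉ Icc x y → z ∉ Ioo x y := fun h h' => h (Ioo_subset_Icc_self h')
    refine ⟨?_, ?_, ?_⟩ <;> rw [disjoint_left] <;> rintro x (rfl | rfl | rfl | rfl | rfl | rfl)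
    exacts [left_notMem_Ioo, right_notMem_Ioo, sub (disjoint_right.1 hab hb1),
      sub (disjoint_right.1 hab hb2), sub (disjoint_right.1 hac hc1),
      sub (disjoint_right.1 hac hc2), sub (disjoint_left.1 hab ha1), sub (disjoint_left.1 hab ha2),
      left_notMem_Ioo, right_notMem_Ioo, sub (disjoint_right.1 hbc hc1),
      sub (disjoint_right.1 hbc hc2), sub (disjoint_left.1 hac ha1), sub (disjoint_left.1 hac ha2),
      sub (disjoint_left.1 hbc hb1), sub (disjoint_left.1 hbc hb2), left_notMem_Ioo,
      right_notMem_Ioo]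
  have hda : Disjoint (D.points : Set ℝ) (Ioo a a') := hPD ▸ disjoint_union_left.2
    ⟨hfa.mono_right Ioo_subset_Icc_self, hsix.1⟩
  have hdb : Disjoint (D.points : Set ℝ) (Ioo b b') := hPD ▸ disjoint_union_left.2
    ⟨hfb.mono_right Ioo_subset_Icc_self, hsix.2.1⟩
  have hdc : Disjoint (D.points : Set ℝ) (Ioo c c') := hPD ▸ disjoint_union_left.2
    ⟨hfc.mono_right Ioo_subset_Icc_self, hsix.2.2⟩
  have hua : (D.points ∪ {a, a'} : Set ℝ) = D.points := by
    rw [union_eq_left, hPD]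
    rintro x (rfl | rfl) <;> simp
  have hub : (D.points ∪ {b, b'} : Set ℝ) = D.points := by
    rw [union_eq_left, hPD]
    rintro x (rfl | rfl) <;> simp
  have huc : (D.points ∪ {c, c'} : Set ℝ) = D.points := by
    rw [union_eq_left, hPD]
    rintro x (rfl | rfl) <;> simp
  have hLa : L a' = R a := (hLR.cont a a' ha hda).symm
  have hLb : L b' = R b := (hLR.cont b b' hb hdb).symm
  have hLc : L c' = R c := (hLR.cont c c' hc hdc).symm
  -- the three middle arcs get the labels `x`, `y` and `z`
  have key : ∀ x y z : V, ∃ L' R' : ℝ → V, IsLabeling (D'.points : Set ℝ) L' R' ∧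
      (L' a = L a ∧ R' a = x ∧ L' a' = x ∧ R' a' = R a') ∧
      (L' b = L b ∧ R' b = y ∧ L' b' = y ∧ R' b' = R b') ∧
      (L' c = L c ∧ R' c = z ∧ L' c' = z ∧ R' c' = R c') ∧
      (∀ᶠ x in atBot, L' x = l) ∧ (∀ᶠ x in atTop, L' x = r) ∧
      ∀ s' t', (s', t') ∈ D₀.arrows →
        CrossingRel σ τ (s' < t') (L' s') (L' t') (R' s') (R' t') := by
    intro x y z
    obtain ⟨L₁, R₁, h', h1, h2, h3, h4, h5⟩ := hLR.exists_override ha x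
    rw [hua] at h'
    obtain ⟨L₂, R₂, k', k1, k2, k3, k4, k5⟩ := h'.exists_override hb y
    rw [hub] at k'
    obtain ⟨L₃, R₃, m', m1, m2, m3, m4, m5⟩ := k'.exists_override hc z
    rw [huc, hPD, ← hPD'] at m'
    obtain ⟨e1, e2⟩ := eventually_eq_of_forall_notMem_Icc fun z hz => (h5 z hz).1
    obtain ⟨e3, e4⟩ := eventually_eq_of_forall_notMem_Icc fun z hz => (k5 z hz).1
    obtain ⟨e5, e6⟩ := eventually_eq_of_forall_notMem_Icc fun z hz => (m5 z hz).1
    refine ⟨L₃, R₃, m', ?_, ?_, ?_, e5.trans (e3.trans (e1.trans hl)),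
      e6.trans (e4.trans (e2.trans hr)), fun s t he => ?_⟩
    · obtain ⟨p1, p2⟩ := k5 _ (disjoint_left.1 hab ha1)
      obtain ⟨p3, p4⟩ := k5 _ (disjoint_left.1 hab ha2)
      obtain ⟨q1, q2⟩ := m5 _ (disjoint_left.1 hac ha1)
      obtain ⟨q3, q4⟩ := m5 _ (disjoint_left.1 hac ha2)
      rw [q1, q2, q3, q4, p1, p2, p3, p4]
      exact ⟨h1, h2, h3, h4⟩
    · obtain ⟨p1, p2⟩ := h5 _ (disjoint_right.1 hab hb1)
      obtain ⟨p3, p4⟩ := h5 _ (disjoint_right.1 hab hb2)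
      obtain ⟨q1, q2⟩ := m5 _ (disjoint_left.1 hbc hb1)
      obtain ⟨q3, q4⟩ := m5 _ (disjoint_left.1 hbc hb2)
      rw [q1, q2, q3, q4, k1, k2, k3, k4]
      exact ⟨p1, rfl, rfl, p4⟩
    · obtain ⟨p1, p2⟩ := h5 _ (disjoint_right.1 hac hc1)
      obtain ⟨p3, p4⟩ := h5 _ (disjoint_right.1 hac hc2)
      obtain ⟨q1, q2⟩ := k5 _ (disjoint_right.1 hbc hc1)
      obtain ⟨q3, q4⟩ := k5 _ (disjoint_right.1 hbc hc2)
      rw [m1, m2, m3, m4, q1, q4, p1, p4]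
      exact ⟨rfl, rfl, rfl, rfl⟩
    · have hs := Finset.mem_coe.2 (fst_mem he)
      have ht := Finset.mem_coe.2 (snd_mem he)
      obtain ⟨p1, p2⟩ := h5 _ (disjoint_left.1 hfa hs)
      obtain ⟨p3, p4⟩ := h5 _ (disjoint_left.1 hfa ht)
      obtain ⟨q1, q2⟩ := k5 _ (disjoint_left.1 hfb hs)
      obtain ⟨q3, q4⟩ := k5 _ (disjoint_left.1 hfb ht)
      obtain ⟨o1, o2⟩ := m5 _ (disjoint_left.1 hfc hs)
      obtain ⟨o3, o4⟩ := m5 _ (disjoint_left.1 hfc ht)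
      rw [o1, o2, o3, o4, q1, q2, q3, q4, p1, p2, p3, p4]
      exact hrel s t (by rcases h with h | h <;> rw [h.1] <;> exact Finset.mem_union_left _ he)
  rcases h with ⟨h, h'⟩ | ⟨h, h'⟩
  · have r1 := hrel a' b (by simp [h])
    have r2 := hrel b' c (by simp [h])
    have r3 := hrel c' a (by simp [h])
    rw [hLa] at r1
    rw [hLb] at r2
    rw [hLc] at r3
    obtain ⟨x, y, z, s1, s2, s3⟩ := CrossingRel.cyclic hστ (fun h => by linarith [h.1, h.2.1, h.2.2])
      (by
        by_contra! h''
        have h1 := (lt_iff_of_disjoint_Icc hab ha1 hb2 ha2 hb1).2.2 (not_lt.2 h''.1)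
        have h2 := (lt_iff_of_disjoint_Icc hbc hb1 hc2 hb2 hc1).2.2 (not_lt.2 h''.2.1)
        have h3 := (lt_iff_of_disjoint_Icc hac.symm hc1 ha2 hc2 ha1).2.2 (not_lt.2 h''.2.2)
        linarith) r1 r2 r3
    obtain ⟨L', R', k', ⟨a1, a2, a3, a4⟩, ⟨b1, b2, b3, b4⟩, ⟨c1, c2, c3, c4⟩, e1, e2, hrel'⟩ :=
      key x y z
    refine ⟨L', R', k', fun s t he => ?_, e1, e2⟩
    simp only [h', Finset.mem_union, Finset.mem_insert, Finset.mem_singleton, Prod.mk.injEq] at he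
    rcases he with he | ⟨rfl, rfl⟩ | ⟨rfl, rfl⟩ | ⟨rfl, rfl⟩
    · exact hrel' s t he
    · rwa [a1, a2, b3, b4, propext (lt_iff_of_disjoint_Icc hab ha1 hb2 ha2 hb1).1]
    · rwa [b1, b2, c3, c4, propext (lt_iff_of_disjoint_Icc hbc hb1 hc2 hb2 hc1).1]
    · rwa [c1, c2, a3, a4, propext (lt_iff_of_disjoint_Icc hac.symm hc1 ha2 hc2 ha1).1]
  · have r1 := hrel a b (by simp [h])
    have r2 := hrel a' c (by simp [h])
    have r3 := hrel b' c' (by simp [h])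
    rw [hLa] at r2
    rw [hLb, hLc] at r3
    obtain ⟨x, y, z, s1, s2, s3⟩ := CrossingRel.transitive hστ
      (fun h1 h2 => by
        have h3 := (lt_iff_of_disjoint_Icc hab ha2 hb1 ha1 hb1).1.2 h1
        have h4 := (lt_iff_of_disjoint_Icc hbc hb2 hc1 hb2 hc2).1.2 h2
        linarith)
      (fun h1 => by
        by_contra! h''
        have h3 := (lt_iff_of_disjoint_Icc hab ha1 hb2 ha1 hb1).2.2 (not_lt.2 h''.1)
        have h4 := (lt_iff_of_disjoint_Icc hbc hb1 hc2 hb2 hc2).2.2 (not_lt.2 h''.2)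
        linarith) r1 r2 r3
    obtain ⟨L', R', k', ⟨a1, a2, a3, a4⟩, ⟨b1, b2, b3, b4⟩, ⟨c1, c2, c3, c4⟩, e1, e2, hrel'⟩ :=
      key x y z
    refine ⟨L', R', k', fun s t he => ?_, e1, e2⟩
    simp only [h', Finset.mem_union, Finset.mem_insert, Finset.mem_singleton, Prod.mk.injEq] at he
    rcases he with he | ⟨rfl, rfl⟩ | ⟨rfl, rfl⟩ | ⟨rfl, rfl⟩
    · exact hrel' s t he
    · rwa [a3, a4, b3, b4, propext (lt_iff_of_disjoint_Icc hab ha2 hb2 ha1 hb1).1]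
    · rwa [a1, a2, c3, c4, propext (lt_iff_of_disjoint_Icc hac ha1 hc2 ha2 hc1).1]
    · rwa [b1, b2, c1, c2, propext (lt_iff_of_disjoint_Icc hbc hb1 hc1 hb2 hc2).1]

theorem Transports.move {D D' : GaussDiagram} (hστ : ∀ x, τ (σ x) = σ (τ x)) (h : Move D D')
    (hD : D.Transports σ τ l r) : D'.Transports σ τ l r := by
  cases h with
  | reparam _ _ φ h => exact hD.reparam φ h
  | one _ _ s t free h => exact hD.one s t free h
  | two _ _ a a' b b' ha hb disj free h => exact hD.two ha hb disj free h
  | three D₀ _ _ a a' b b' c c' ha hb hc hab hbc hac free h =>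
    exact hD.three hστ ha hb hc hab hbc hac free h

/-! ### Colorings by words and the endomorphism `Φ` -/

/-- The translation `x ↦ (n ↦ x (n + m))` of families indexed by `ℤ²`. -/
def shift (Γ : Type*) [Group Γ] (m : ℤ × ℤ) : (ℤ × ℤ → Γ) ≃* (ℤ × ℤ → Γ) where
  toFun x n := x (n + m)
  invFun x n := x (n - m)
  left_inv x := by simp
  right_inv x := by simp
  map_mul' x y := rfl

theorem shift_comm {Γ : Type*} [Group Γ] (m m' : ℤ × ℤ) (x : ℤ × ℤ → Γ) :
    shift Γ m (shift Γ m' x) = shift Γ m' (shift Γ m x) :=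
  funext fun n => congrArg x (add_right_comm n m m')

theorem before_le_before (D : GaussDiagram) {x y : ℝ} (h : x ≤ y) :
    (D.before x : ℕ) ≤ D.before y :=
  Finset.card_le_card fun _ hz => Finset.mem_filter.2
    ⟨(Finset.mem_filter.1 hz).1, (Finset.mem_filter.1 hz).2.trans_le h⟩

/-- The arc that contains the points just after `x` contains the points just before `y`, if no
distinguished point lies between `x` and `y`. -/
theorem after_eq_before (D : GaussDiagram) {x y : ℝ} (hxy : x < y)
    (h : Disjoint (D.points : Set ℝ) (Ioo x y)) : D.after x = D.before y := by
  refine Fin.ext (congrArg Finset.card (Finset.filter_congr fun z hz => ?_))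
  exact ⟨fun h' => h'.trans_lt hxy, fun h' => not_lt.1 fun h'' => disjoint_left.1 h hz ⟨h'', h'⟩⟩

theorem before_eq_after (D : GaussDiagram) {x : ℝ} (h : x ∉ D.points) :
    D.before x = D.after x := by
  refine Fin.ext (congrArg Finset.card (Finset.filter_congr fun z hz => ?_))
  exact ⟨le_of_lt, fun h' => lt_of_le_of_ne h' fun h'' => h (h'' ▸ hz)⟩

theorem eventually_before_eq_zero (D : GaussDiagram) : ∀ᶠ x in atBot, D.before x = 0 := by
  filter_upwards [(Finset.eventually_all D.points).2 fun y _ => eventually_lt_atBot y] with x hx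
  refine Fin.ext ?_
  simp only [before, Fin.val_zero, Finset.card_eq_zero, Finset.filter_eq_empty_iff]
  exact fun y hy => (hx y hy).not_gt

theorem eventually_before_eq_last (D : GaussDiagram) :
    ∀ᶠ x in atTop, D.before x = Fin.last D.size := by
  filter_upwards [(Finset.eventually_all D.points).2 fun y _ => eventually_gt_atTop y] with x hx
  refine Fin.ext ?_
  simp only [before, Fin.val_last, size]
  rw [Finset.filter_true_of_mem hx]

theorem _root_.IsLabeling.eq_of_before_eq {D : GaussDiagram} {W : Type*} {L R : ℝ → W}
    (h : IsLabeling (D.points : Set ℝ) L R) {x y : ℝ} (hxy : D.before x = D.before y) :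
    L x = L y := by
  wlog hlt : x < y generalizing x y
  · rcases (not_lt.1 hlt).lt_or_eq with h' | h'
    exacts [(this hxy.symm h').symm, by rw [h']]
  have hd : ∀ z ∈ D.points, x ≤ z → ¬ z < y := fun z hz h1 h2 => by
    have := D.before_le_before h1
    have := after_le_before (D := D) h2
    have := after_val hz
    omega
  rw [h.reg x fun hx => hd x hx le_rfl hlt]
  exact h.cont x y hlt (disjoint_left.2 fun z hz hz' => hd z hz hz'.1.le hz'.2)

theorem exists_before_eq (D : GaussDiagram) (k : Fin (D.size + 1)) : ∃ x, D.before x = k := by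
  rcases (Nat.le_of_lt_succ k.2).lt_or_eq with h | h
  · obtain ⟨p, -, hp⟩ := exists_before h
    exact ⟨p, Fin.ext hp⟩
  · obtain ⟨x, hx⟩ := D.eventually_before_eq_last.exists
    exact ⟨x, hx.trans (Fin.ext h.symm)⟩

/-- A coloring is a homomorphism from the extended Alexander group. -/
theorem exists_lift_of_isLabeling {Γ : Type*} [Group Γ] {D : GaussDiagram}
    {L R : ℝ → ℤ × ℤ → Γ} (h : IsLabeling (D.points : Set ℝ) L R)
    (hrel : ∀ s t, (s, t) ∈ D.arrows →
      CrossingRel (shift Γ (1, 0)) (shift Γ (0, 1)) (s < t) (L s) (L t) (R s) (R t)) :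
    ∃ f : D.AlexanderGroup →* Γ, ∀ x n, f (D.gen (D.before x) n) = L x n := by
  choose p hp using D.exists_before_eq
  have hL : ∀ x, L (p (D.before x)) = L x := fun x => h.eq_of_before_eq (hp _)
  have hR : ∀ x ∈ D.points, L (p (D.after x)) = R x := fun x hx => by
    have hlt : x < p (D.after x) := by
      by_contra! h'
      have h1 := D.before_le_before h'
      have h2 := after_val hx
      rw [hp] at h1
      omega
    refine (h.cont _ _ hlt (disjoint_left.2 fun z hz hz' => ?_)).symm
    have h1 := after_le_before (D := D) hz'.1
    have h2 := after_le_before (D := D) hz'.2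
    have h3 := after_val (Finset.mem_coe.1 hz)
    rw [hp] at h2
    omega
  let f : Fin (D.size + 1) × (ℤ × ℤ) → Γ := fun y => L (p y.1) y.2
  have hf : ∀ r ∈ {r | D.Relator r}, FreeGroup.lift f r = 1 := by
    rintro r (⟨s, t, he, n⟩ | ⟨s, t, he, hst, n⟩ | ⟨s, t, he, hts, n⟩)
    · rw [map_mul, map_inv, mul_inv_eq_one]
      simpa [shift, f, hL, hR s (fst_mem he), hR t (snd_mem he)] using
        congrFun (hrel s t he).crossing n
    · rw [map_mul, map_inv, mul_inv_eq_one]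
      simpa [shift, f, hL, hR s (fst_mem he)] using congrFun ((hrel s t he).pos hst) n
    · rw [map_mul, map_inv, mul_inv_eq_one]
      simpa [shift, f, hL, hR t (snd_mem he)] using congrFun ((hrel s t he).neg hts.not_gt) n
  exact ⟨PresentedGroup.toGroup hf, fun x n => by simp [gen, f, hL]⟩

/-- The word of the right end is the right end of the coloring by words that is tautological on the
left end. -/
theorem transports_phi (D : GaussDiagram) :
    D.Transports (shift (FreeGroup (ℤ × ℤ)) (1, 0)) (shift (FreeGroup (ℤ × ℤ)) (0, 1))
      FreeGroup.of fun n => D.Phi (FreeGroup.of n) := by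
  let w : Fin (D.size + 1) → ℤ × ℤ → FreeGroup (ℤ × ℤ) := fun k n => D.leftEquiv.symm (D.gen k n)
  refine ⟨fun x => w (D.before x), fun x => w (D.after x), ⟨fun _ _ hxy h =>
    congrArg w (D.after_eq_before hxy h), fun _ h => congrArg w (D.before_eq_after h)⟩,
    fun s t he => ⟨funext fun n => ?_, fun hst => funext fun n => ?_,
    fun hst => funext fun n => ?_⟩, D.eventually_before_eq_zero.mono fun x hx => funext fun n => ?_,
    D.eventually_before_eq_last.mono fun x hx => funext fun n => ?_⟩
  · simp only [w, Pi.mul_apply, shift, MulEquiv.coe_mk, Equiv.coe_fn_mk, ← map_mul]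
    rw [gen_crossing he]
  · exact congrArg D.leftEquiv.symm (gen_positive he hst n)
  · exact congrArg D.leftEquiv.symm
      (gen_negative he (lt_of_le_of_ne (not_lt.1 hst) (D.ne _ he).symm) n)
  · simp only [hx, w]
    rw [MulEquiv.symm_apply_eq]
    simp [leftEquiv, fromLeft]
  · simp [hx, w, Phi, fromRight]

theorem Transports.eq_phi {D : GaussDiagram} {r : ℤ × ℤ → FreeGroup (ℤ × ℤ)}
    (h : D.Transports (shift _ (1, 0)) (shift _ (0, 1)) FreeGroup.of r) (n : ℤ × ℤ) :
    D.Phi (FreeGroup.of n) = r n := by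
  obtain ⟨L, R, hLR, hrel, hl, hr⟩ := h
  obtain ⟨f, hf⟩ := exists_lift_of_isLabeling hLR hrel
  obtain ⟨x, hx0, hx⟩ := (D.eventually_before_eq_zero.and hl).exists
  obtain ⟨y, hy0, hy⟩ := (D.eventually_before_eq_last.and hr).exists
  have hcomp : f.comp D.fromLeft = MonoidHom.id _ := by
    ext m
    simp [fromLeft, ← hx0, hf, hx]
  have hsymm : ∀ g, D.leftEquiv.symm g = f g := fun g => by
    obtain ⟨g, rfl⟩ := D.leftEquiv.surjective g
    rw [MulEquiv.symm_apply_apply]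
    exact (DFunLike.congr_fun hcomp g).symm
  simp only [Phi, MonoidHom.comp_apply, MulEquiv.coe_toMonoidHom, hsymm, fromRight,
    FreeGroup.lift_apply_of]
  rw [← hy0, hf, hy]

/-- `Φ` is an invariant of homotopy. -/
theorem Homotopic.phi_eq {D D' : GaussDiagram} (h : D.Homotopic D') : D.Phi = D'.Phi := by
  induction h with
  | rel D D' h =>
    refine FreeGroup.ext_hom _ _ fun n => ?_
    exact ((D.transports_phi.move (fun x => shift_comm _ _ x) h).eq_phi n).symm
  | refl => rfl
  | symm _ _ _ ih => exact ih.symm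
  | trans _ _ _ _ _ ih₁ ih₂ => exact ih₁.trans ih₂

theorem phi_eq_id_of_gen_eq {D : GaussDiagram} (h : D.gen 0 = D.gen (Fin.last D.size)) :
    D.Phi = MonoidHom.id _ := by
  have : D.fromRight = D.fromLeft := by rw [fromRight, fromLeft, h]
  refine MonoidHom.ext fun g => ?_
  rw [Phi, this]
  exact D.leftEquiv.symm_apply_apply g

end GaussDiagram

namespace OpenString

/-! ### Tubular coordinates along an open string -/

section Tube

variable (α : OpenString)

/-- The tubular map of an open string: it maps `(s, r)` to the end point of `r` times the normal
vector at the parameter `s` that points to the left. It is a diffeomorphism near each `(s, 0)`. -/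
noncomputable def tube (w : ℝ × ℝ) : ℝ × ℝ :=
  α.curve w.1 + w.2 • (-(deriv α.curve w.1).2, (deriv α.curve w.1).1)

/-- The image of an open string. -/
def image : Set (ℝ × ℝ) := range α.curve

/-- The double points of an open string, as points of the plane. -/
def doublePoints : Set (ℝ × ℝ) := {p | ∃ x y, x ≠ y ∧ α.curve x = p ∧ α.curve y = p}

variable {α}

theorem curve_mem (s : ℝ) : α.curve s ∈ α.image := mem_range_self s

@[simp] theorem tube_zero (s : ℝ) : α.tube (s, 0) = α.curve s := by simp [tube]

theorem countable_doublePoints : α.doublePoints.Countable := by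
  refine ((α.finite.image α.curve).subset ?_).countable
  rintro p ⟨x, y, hxy, hx, hy⟩
  exact ⟨x, ⟨y, hxy.symm, hy.trans hx.symm⟩, hx⟩

theorem doublePoints_subset_image : α.doublePoints ⊆ α.image := by
  rintro p ⟨x, -, -, rfl, -⟩
  exact curve_mem x

theorem dense_compl_image : Dense (α.imageᶜ) :=
  (α.smooth.of_le (by exact_mod_cast le_top)).dense_compl_range_of_finrank_lt_finrank (by simp)

theorem hasDerivAt (s : ℝ) : HasDerivAt α.curve (deriv α.curve s) s :=
  (α.smooth.differentiable (by simp) s).hasDerivAt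

theorem isClosedMap_curve : IsClosedMap α.curve := by
  refine (isProperMap_iff_tendsto_cocompact.2 ⟨α.smooth.continuous, ?_⟩).isClosedMap
  rw [← Metric.cobounded_eq_cocompact (α := ℝ × ℝ), ← tendsto_norm_atTop_iff_cobounded]
  obtain ⟨R, hR⟩ := α.standard
  refine (tendsto_norm_cocompact_atTop (E := ℝ)).congr' ?_
  filter_upwards [(tendsto_norm_cocompact_atTop (E := ℝ)).eventually_ge_atTop R] with x hx
  rw [hR x hx]
  simp [Prod.norm_def]

theorem isClosed_image : IsClosed α.image := by
  rw [image, ← image_univ]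
  exact isClosedMap_curve _ isClosed_univ

/-- Points of the curve near `p` have parameters near the parameters of `p`. -/
theorem eventually_forall_curve_eq {p : ℝ × ℝ} {K : ℝ → Prop}
    (h : ∀ s, α.curve s = p → ∀ᶠ s' in 𝓝 s, K s') : ∀ᶠ q in 𝓝 p, ∀ s, α.curve s = q → K s := by
  have : ∀ᶠ s in comap α.curve (𝓝 p), K s := by
    rw [isClosedMap_curve.comap_nhds_eq α.smooth.continuous, eventually_nhdsSet_iff_forall]
    exact fun s hs => h s hs
  rw [eventually_comap] at this
  exact this

/-- The derivative of the tubular map along the curve is a similarity. -/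
theorem exists_hasStrictFDerivAt_tube (s : ℝ) : ∃ A : (ℝ × ℝ) ≃L[ℝ] ℝ × ℝ,
    HasStrictFDerivAt α.tube (A : (ℝ × ℝ) →L[ℝ] ℝ × ℝ) (s, 0) ∧
    ∃ N > 0, ∀ v, (A.symm v).2 = planeDet (deriv α.curve s) v / N := by
  set p := (deriv α.curve s).1 with hp
  set q := (deriv α.curve s).2 with hq
  have hN : 0 < p ^ 2 + q ^ 2 := by
    have h := α.immersion s
    rw [Ne, Prod.ext_iff, not_and_or] at h
    rcases h with h | h
    · have : p ≠ 0 := h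
      positivity
    · have : q ≠ 0 := h
      positivity
  let fst := ContinuousLinearMap.fst ℝ ℝ ℝ
  let snd := ContinuousLinearMap.snd ℝ ℝ ℝ
  let A₁ : (ℝ × ℝ) →L[ℝ] ℝ × ℝ := (p • fst - q • snd).prod (q • fst + p • snd)
  let A₂ : (ℝ × ℝ) →L[ℝ] ℝ × ℝ := ((p ^ 2 + q ^ 2)⁻¹ • (p • fst + q • snd)).prod
    ((p ^ 2 + q ^ 2)⁻¹ • (p • snd - q • fst))
  let A : (ℝ × ℝ) ≃L[ℝ] ℝ × ℝ := ContinuousLinearEquiv.equivOfInverse A₁ A₂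
    (fun v => by
      ext <;> simp [A₁, A₂, fst, snd] <;> field_simp <;> ring)
    (fun v => by
      ext <;> simp [A₁, A₂, fst, snd] <;> field_simp <;> ring)
  refine ⟨A, ?_, p ^ 2 + q ^ 2, hN, fun v => ?_⟩
  · have hsm : ContDiff ℝ (⊤ : ℕ∞) (deriv α.curve) := (contDiff_infty_iff_deriv.1 α.smooth).2
    have hJ : ContDiff ℝ (⊤ : ℕ∞)
        fun w : ℝ × ℝ => (-(deriv α.curve w.1).2, (deriv α.curve w.1).1) :=
      ((hsm.comp contDiff_fst).snd.neg).prodMk (hsm.comp contDiff_fst).fst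
    have hc : ContDiff ℝ (⊤ : ℕ∞) α.tube :=
      (α.smooth.comp contDiff_fst).add (contDiff_snd.smul hJ)
    refine hc.contDiffAt.hasStrictFDerivAt' ?_ (by simp)
    have h1 : HasFDerivAt (fun w : ℝ × ℝ => α.curve w.1) _ (s, 0) :=
      HasFDerivAt.comp (s, (0 : ℝ)) (hasDerivAt (α := α) s).hasFDerivAt hasFDerivAt_fst
    have h2 := (hasFDerivAt_snd (𝕜 := ℝ) (p := (s, (0 : ℝ)))).smul
      (hJ.differentiable (by simp) (s, 0)).hasFDerivAt
    refine (h1.add h2).congr_fderiv ?_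
    ext <;> simp [A, A₁, fst, snd, hp, hq]
  · change (p ^ 2 + q ^ 2)⁻¹ * (p * v.2 - q * v.1) = _
    rw [planeDet, div_eq_inv_mul]

theorem map_tube_nhds (s : ℝ) : map α.tube (𝓝 (s, 0)) = 𝓝 (α.curve s) := by
  obtain ⟨A, hA, -⟩ := exists_hasStrictFDerivAt_tube (α := α) s
  rw [hA.map_nhds_eq_of_equiv, tube_zero]

theorem continuousAt_tube (s : ℝ) : Tendsto α.tube (𝓝 (s, 0)) (𝓝 (α.curve s)) :=
  (map_tube_nhds s).le

/-- Near each of its points, the curve is the zero set of a function that is positive on the left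
and negative on the right of the curve. Along another strand through the point, the sign of this
function is determined by the direction in which that strand crosses the first one. -/
theorem exists_side (α : OpenString) (s : ℝ) : ∃ f : ℝ × ℝ → ℝ,
    (∀ᶠ s' in 𝓝 s, ∀ᶠ w in 𝓝 (s', 0), f (α.tube w) = w.2) ∧
    (∀ᶠ q in 𝓝 (α.curve s), ContinuousAt f q ∧ (f q = 0 → q ∈ α.image)) ∧
    ∀ t, α.curve t = α.curve s →
      (0 < planeDet (deriv α.curve s) (deriv α.curve t) →
        ∀ᶠ t' in 𝓝 t, SignType.sign (f (α.curve t')) = SignType.sign (t' - t)) ∧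
      (planeDet (deriv α.curve s) (deriv α.curve t) < 0 →
        ∀ᶠ t' in 𝓝 t, SignType.sign (f (α.curve t')) = SignType.sign (t - t')) := by
  obtain ⟨A, hA, N, hN, hAN⟩ := exists_hasStrictFDerivAt_tube (α := α) s
  set e := hA.toOpenPartialHomeomorph α.tube with he
  have hcoe : (e : ℝ × ℝ → ℝ × ℝ) = α.tube := hA.toOpenPartialHomeomorph_coe
  have hs : (s, (0 : ℝ)) ∈ e.source := hA.mem_toOpenPartialHomeomorph_source
  have hs' : α.curve s ∈ e.target := by
    have := e.map_source hs
    rwa [hcoe, tube_zero] at this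
  have hsymm : e.symm (α.curve s) = (s, 0) := by
    have := e.left_inv hs
    rwa [hcoe, tube_zero] at this
  refine ⟨fun q => (e.symm q).2, ?_, ?_, fun t ht => ?_⟩
  · have hev : ∀ᶠ w in 𝓝 (s, (0 : ℝ)), w ∈ e.source := e.open_source.mem_nhds hs
    have hc : Tendsto (fun s' : ℝ => (s', (0 : ℝ))) (𝓝 s) (𝓝 (s, 0)) :=
      (Continuous.prodMk_left 0).tendsto s
    filter_upwards [hc.eventually hev] with s' hs'
    filter_upwards [e.open_source.mem_nhds hs'] with w hw
    rw [← hcoe, e.left_inv hw]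
  · filter_upwards [e.open_target.mem_nhds hs'] with q hq
    refine ⟨(e.symm.continuousAt hq).snd, fun h0 => ⟨(e.symm q).1, ?_⟩⟩
    have := e.right_inv hq
    rwa [hcoe, show e.symm q = ((e.symm q).1, 0) from Prod.ext rfl h0, tube_zero] at this
  · have h1 : HasFDerivAt e.symm (A.symm : (ℝ × ℝ) →L[ℝ] ℝ × ℝ) (α.curve s) := by
      refine e.hasFDerivAt_symm hs' ?_
      rw [hcoe, hsymm]
      exact hA.hasFDerivAt
    rw [← ht] at h1
    have h2 : HasDerivAt (fun t' => (e.symm (α.curve t')).2)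
        (planeDet (deriv α.curve s) (deriv α.curve t) / N) t := by
      rw [← hAN]
      exact HasFDerivAt.comp_hasDerivAt t hasFDerivAt_snd (h1.comp_hasDerivAt t (hasDerivAt t))
    have h0 : (e.symm (α.curve t)).2 = 0 := by rw [ht, hsymm]
    refine ⟨fun hd => ?_, fun hd => ?_⟩
    · refine eventually_nhdsWithin_sign_eq_of_deriv_pos ?_ h0
      rw [h2.deriv]
      exact div_pos hd hN
    · refine eventually_nhdsWithin_sign_eq_of_deriv_neg ?_ h0
      rw [h2.deriv]
      exact div_neg_of_neg_of_pos hd hN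

end Tube

end OpenString

namespace OpenString

/-! ### Functions on the complement of the curve with prescribed jumps -/

section Jump

variable {α : OpenString} {Γ : Type*} [Group Γ] {X : ℝ → Γ} {G G' : ℝ × ℝ → Γ}

/-- `G` has the jump prescribed by `X` at the parameter `s`: it is locally constant on both sides of
the curve, and its value on the right is `X s` times its value on the left. The values of `G` on the
curve do not matter. -/
def HasJump (α : OpenString) (X : ℝ → Γ) (G : ℝ × ℝ → Γ) (s : ℝ) : Prop :=
  ∃ g, ∀ᶠ w in 𝓝 (s, (0 : ℝ)), α.tube w ∉ α.image →
    (0 < w.2 → G (α.tube w) = g) ∧ (w.2 < 0 → G (α.tube w) = X s * g)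

/-- `G` is locally constant near `q` on the complement of the curve, and has the jumps prescribed by
`X` if `q` is on the curve. -/
structure IsSolAt (α : OpenString) (X : ℝ → Γ) (G : ℝ × ℝ → Γ) (q : ℝ × ℝ) : Prop where
  off : q ∉ α.image → ∃ g, ∀ᶠ z in 𝓝 q, z ∉ α.image → G z = g
  jump : ∀ s, α.curve s = q → HasJump α X G s

/-- `G` is a face labeling of the complement of the curve in `U` whose jumps across the curve are
prescribed by `X`. No condition is imposed at double points. -/
def IsSolOn (α : OpenString) (X : ℝ → Γ) (G : ℝ × ℝ → Γ) (U : Set (ℝ × ℝ)) : Prop :=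
  ∀ q ∈ U, q ∉ α.doublePoints → IsSolAt α X G q

theorem IsSolAt.congr {q : ℝ × ℝ} (h : IsSolAt α X G q)
    (hG : ∀ᶠ z in 𝓝 q, z ∉ α.image → G' z = G z) : IsSolAt α X G' q := by
  refine ⟨fun hq => ?_, fun s hs => ?_⟩
  · obtain ⟨g, hg⟩ := h.off hq
    refine ⟨g, ?_⟩
    filter_upwards [hg, hG] with z h1 h2 hz
    rw [h2 hz, h1 hz]
  · obtain ⟨g, hg⟩ := h.jump s hs
    subst hs
    refine ⟨g, ?_⟩
    filter_upwards [hg, (continuousAt_tube s).eventually hG] with w h1 h2 hw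
    rw [h2 hw]
    exact h1 hw

theorem IsSolAt.mul_right {q : ℝ × ℝ} (h : IsSolAt α X G q) (c : Γ) :
    IsSolAt α X (fun z => G z * c) q := by
  refine ⟨fun hq => ?_, fun s hs => ?_⟩
  · obtain ⟨g, hg⟩ := h.off hq
    exact ⟨g * c, hg.mono fun z h1 hz => by rw [h1 hz]⟩
  · obtain ⟨g, hg⟩ := h.jump s hs
    refine ⟨g * c, hg.mono fun w h1 hw => ⟨fun h2 => ?_, fun h2 => ?_⟩⟩
    · exact congrArg (· * c) ((h1 hw).1 h2)
    · exact (congrArg (· * c) ((h1 hw).2 h2)).trans (mul_assoc _ _ _)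

/-- The quotient of two solutions does not jump. -/
theorem IsSolAt.eventually_inv_mul_eq {q : ℝ × ℝ} (h : IsSolAt α X G q) (h' : IsSolAt α X G' q) :
    ∃ c, ∀ᶠ z in 𝓝 q, z ∉ α.image → (G z)⁻¹ * G' z = c := by
  by_cases hq : q ∈ α.image
  · obtain ⟨s, rfl⟩ := hq
    obtain ⟨g, hg⟩ := h.jump s rfl
    obtain ⟨g', hg'⟩ := h'.jump s rfl
    refine ⟨g⁻¹ * g', ?_⟩
    rw [← map_tube_nhds, eventually_map]
    filter_upwards [hg, hg'] with w h1 h2 hw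
    rcases lt_trichotomy w.2 0 with h3 | h3 | h3
    · rw [(h1 hw).2 h3, (h2 hw).2 h3]
      group
    · refine absurd ?_ hw
      rw [show w = (w.1, 0) from Prod.ext rfl h3, tube_zero]
      exact curve_mem _
    · rw [(h1 hw).1 h3, (h2 hw).1 h3]
  · obtain ⟨g, hg⟩ := h.off hq
    obtain ⟨g', hg'⟩ := h'.off hq
    refine ⟨g⁻¹ * g', ?_⟩
    filter_upwards [hg, hg'] with z h1 h2 hz
    rw [h1 hz, h2 hz]

/-- Two solutions differ by a constant factor on the right, as removing the double points from `U`
does not disconnect it. -/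
theorem IsSolOn.exists_eq_mul {U : Set (ℝ × ℝ)} (hU : IsPreconnected (U \ α.doublePoints))
    (h : IsSolOn α X G U) (h' : IsSolOn α X G' U) :
    ∃ c, ∀ z ∈ U, z ∉ α.image → G z = G' z * c := by
  by_cases hne : ∃ z₀ ∈ U, z₀ ∉ α.image
  swap
  · exact ⟨1, fun z hz hz' => absurd ⟨z, hz, hz'⟩ hne⟩
  obtain ⟨z₀, hz₀, hz₀'⟩ := hne
  refine ⟨(G' z₀)⁻¹ * G z₀, fun z hz hz' => ?_⟩
  let P : ℝ × ℝ → ℝ × ℝ → Prop := fun x y => ∃ c,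
    (∀ᶠ w in 𝓝 x, w ∉ α.image → (G' w)⁻¹ * G w = c) ∧
    ∀ᶠ w in 𝓝 y, w ∉ α.image → (G' w)⁻¹ * G w = c
  have hP : P z z₀ := by
    refine hU.induction₂ P (fun x hx => ?_) ?_ (fun x y _ _ ⟨c, h1, h2⟩ => ⟨c, h2, h1⟩)
      ⟨hz, fun h => hz' (doublePoints_subset_image h)⟩
      ⟨hz₀, fun h => hz₀' (doublePoints_subset_image h)⟩
    · obtain ⟨c, hc⟩ := (h' x hx.1 hx.2).eventually_inv_mul_eq (h x hx.1 hx.2)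
      exact (eventually_nhdsWithin_of_eventually_nhds hc.eventually_nhds).mono
        fun y hy => ⟨c, hc, hy⟩
    · rintro x y z - - - ⟨c, h1, h2⟩ ⟨d, h3, h4⟩
      -- the complement of the curve accumulates at `y`, so the two constants agree
      obtain ⟨w, hw, h5, h6⟩ := (mem_closure_iff_frequently.1
        (dense_compl_image (α := α) y)).and_eventually (h2.and h3) |>.exists
      obtain rfl : c = d := (h5 hw).symm.trans (h6 hw)
      exact ⟨c, h1, h4⟩
  obtain ⟨c, h1, h2⟩ := hP
  rw [h2.self_of_nhds hz₀', ← h1.self_of_nhds hz', mul_inv_cancel_left]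

theorem IsSolOn.mono {U V : Set (ℝ × ℝ)} (h : IsSolOn α X G U) (hVU : V ⊆ U) : IsSolOn α X G V :=
  fun q hq => h q (hVU hq)

theorem IsSolOn.exists_union {U V : Set (ℝ × ℝ)} (hU : IsOpen U) (hV : IsOpen V)
    (hUV : IsPreconnected ((U ∩ V) \ α.doublePoints)) (h : IsSolOn α X G U)
    (h' : IsSolOn α X G' V) : ∃ G'', IsSolOn α X G'' (U ∪ V) := by
  classical
  obtain ⟨c, hc⟩ := IsSolOn.exists_eq_mul hUV (h.mono inter_subset_left)
    (h'.mono inter_subset_right)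
  refine ⟨U.piecewise G fun z => G' z * c, ?_⟩
  rintro q (hq | hq) hqd
  · refine (h q hq hqd).congr ?_
    filter_upwards [hU.mem_nhds hq] with z hz _
    rw [piecewise_eq_of_mem _ _ _ hz]
  · refine ((h' q hq hqd).mul_right c).congr ?_
    filter_upwards [hV.mem_nhds hq] with z hz hz'
    by_cases hzU : z ∈ U
    · rw [piecewise_eq_of_mem _ _ _ hzU, hc z ⟨hzU, hz⟩ hz']
    · rw [piecewise_eq_of_notMem _ _ _ hzU]

end Jump

/-! ### Gluing over rectangles -/

/-- An open rectangle minus a countable set is connected: it is an injective image of the plane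
minus a countable set. -/
theorem isPreconnected_rectangle_diff {D : Set (ℝ × ℝ)} (hD : D.Countable) (a b c d : ℝ) :
    IsPreconnected ((Ioo a b ×ˢ Ioo c d) \ D) := by
  have key : ∀ a b : ℝ, a < b → ∃ f : ℝ → ℝ, Continuous f ∧ Function.Injective f ∧
      range f = Ioo a b := by
    intro a b hab
    have hpi := Real.pi_pos
    have hk : 0 < (b - a) / Real.pi := div_pos (sub_pos.2 hab) hpi
    refine ⟨fun x => (b - a) / Real.pi * Real.arctan x + (a + b) / 2, by fun_prop,
      fun x y hxy => ?_, ?_⟩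
    · exact Real.arctan_injective (mul_left_cancel₀ hk.ne' (add_right_cancel hxy))
    · have h1 : range (fun x => (b - a) / Real.pi * Real.arctan x + (a + b) / 2) =
          (fun y => (b - a) / Real.pi * y + (a + b) / 2) '' range Real.arctan := by
        rw [← range_comp]
        rfl
      rw [h1, Real.range_arctan, image_affine_Ioo hk]
      congr 1 <;> field_simp <;> ring
  rcases le_or_gt b a with hab | hab
  · simp [Ioo_eq_empty (not_lt.2 hab), isPreconnected_empty]
  rcases le_or_gt d c with hcd | hcd
  · simp [Ioo_eq_empty (not_lt.2 hcd), isPreconnected_empty]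
  obtain ⟨f, hf, hfi, hfr⟩ := key a b hab
  obtain ⟨g, hg, hgi, hgr⟩ := key c d hcd
  have hc := (hD.preimage (hfi.prodMap hgi)).isConnected_compl_of_one_lt_rank
    (E := ℝ × ℝ) (by rw [← Module.finrank_eq_rank]; norm_num)
  have := hc.isPreconnected.image _ (hf.prodMap hg).continuousOn
  rwa [← preimage_compl, image_preimage_eq_inter_range, range_prodMap, hfr, hgr, inter_comm,
    ← sdiff_eq] at this

/-- A property of intervals that holds locally and is preserved by gluing overlapping intervals
holds for all intervals. -/
theorem forall_interval_of_local {P : ℝ → ℝ → Prop}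
    (mono : ∀ a b a' b', a ≤ a' → b' ≤ b → P a b → P a' b')
    (glue : ∀ a b c d, b < c → P a c → P b d → P a d) (loc : ∀ t, ∃ ε > 0, P (t - ε) (t + ε))
    (a b : ℝ) : P a b := by
  by_contra hab
  have hbdd : BddAbove {x | P a x} :=
    ⟨b, fun x hx => le_of_not_gt fun h => hab (mono a x a b le_rfl h.le hx)⟩
  have hne : {x | P a x}.Nonempty := by
    obtain ⟨ε, hε, h⟩ := loc a
    exact ⟨a + ε, mono _ _ _ _ (by linarith) le_rfl h⟩
  obtain ⟨ε, hε, h⟩ := loc (sSup {x | P a x})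
  obtain ⟨x, hx, hlt⟩ := exists_lt_of_lt_csSup hne (sub_lt_self (sSup {x | P a x}) hε)
  have := le_csSup hbdd (glue _ _ _ _ hlt hx h)
  linarith

section Rectangle

variable {α : OpenString} {Γ : Type*} [Group Γ] {X : ℝ → Γ}

/-- Local solutions glue to a solution on a rectangle. -/
theorem exists_isSolOn_rectangle
    (hloc : ∀ p, ∃ G, ∀ᶠ q in 𝓝 p, q ∉ α.doublePoints → IsSolAt α X G q) (a b c d : ℝ) :
    ∃ G, IsSolOn α X G (Ioo a b ×ˢ Ioo c d) := by
  have glue : ∀ a b c d a' b' c' d' a'' b'' c'' d'' : ℝ,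
      Ioo a'' b'' ×ˢ Ioo c'' d'' ⊆ Ioo a b ×ˢ Ioo c d ∪ Ioo a' b' ×ˢ Ioo c' d' →
      (∃ G, IsSolOn α X G (Ioo a b ×ˢ Ioo c d)) → (∃ G, IsSolOn α X G (Ioo a' b' ×ˢ Ioo c' d')) →
      ∃ G, IsSolOn α X G (Ioo a'' b'' ×ˢ Ioo c'' d'') := by
    rintro a b c d a' b' c' d' a'' b'' c'' d'' hsub ⟨G, hG⟩ ⟨G', hG'⟩
    obtain ⟨H, hH⟩ := hG.exists_union (isOpen_Ioo.prod isOpen_Ioo) (isOpen_Ioo.prod isOpen_Ioo)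
      (by
        rw [prod_inter_prod, Ioo_inter_Ioo, Ioo_inter_Ioo]
        exact isPreconnected_rectangle_diff countable_doublePoints _ _ _ _) hG'
    exact ⟨H, hH.mono hsub⟩
  have mono : ∀ a b c d a' b' c' d' : ℝ, a ≤ a' → b' ≤ b → c ≤ c' → d' ≤ d →
      (∃ G, IsSolOn α X G (Ioo a b ×ˢ Ioo c d)) → ∃ G, IsSolOn α X G (Ioo a' b' ×ˢ Ioo c' d') :=
    fun a b c d a' b' c' d' h1 h2 h3 h4 ⟨G, hG⟩ =>
      ⟨G, hG.mono (prod_mono (Ioo_subset_Ioo h1 h2) (Ioo_subset_Ioo h3 h4))⟩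
  have cover : ∀ {a b c d : ℝ}, b < c → Ioo a d ⊆ Ioo a c ∪ Ioo b d := by
    intro a b c d hbc x hx
    rcases lt_or_ge x c with h | h
    exacts [Or.inl ⟨hx.1, h⟩, Or.inr ⟨hbc.trans_le h, hx.2⟩]
  -- glue along the horizontal line through `(0, y)`, then glue horizontal strips
  have strip : ∀ y a b : ℝ, ∃ ε > 0, ∃ G, IsSolOn α X G (Ioo a b ×ˢ Ioo (y - ε) (y + ε)) := by
    intro y
    refine forall_interval_of_local ?_ ?_ fun t => ?_
    · rintro a b a' b' h1 h2 ⟨ε, hε, h⟩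
      exact ⟨ε, hε, mono _ _ _ _ _ _ _ _ h1 h2 le_rfl le_rfl h⟩
    · rintro a b c d hbc ⟨ε, hε, h⟩ ⟨δ, hδ, h'⟩
      have h1 := min_le_left ε δ
      have h2 := min_le_right ε δ
      refine ⟨min ε δ, lt_min hε hδ, glue _ _ _ _ _ _ _ _ _ _ _ _ ?_
        (mono _ _ _ _ _ _ (y - min ε δ) (y + min ε δ) le_rfl le_rfl (by linarith) (by linarith) h)
        (mono _ _ _ _ _ _ (y - min ε δ) (y + min ε δ) le_rfl le_rfl (by linarith) (by linarith)
          h')⟩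
      rw [← union_prod]
      exact prod_mono_left (cover hbc)
    · obtain ⟨G, hG⟩ := hloc (t, y)
      obtain ⟨ε, hε, h⟩ := Metric.eventually_nhds_iff_ball.1 hG
      refine ⟨ε, hε, ε, hε, G, fun q hq => h q ?_⟩
      rwa [← ball_prod_same, Real.ball_eq_Ioo, Real.ball_eq_Ioo]
  refine forall_interval_of_local
    (P := fun c d => ∃ G, IsSolOn α X G (Ioo a b ×ˢ Ioo c d)) ?_ ?_ ?_ c d
  · exact fun c d c' d' h1 h2 h => mono _ _ _ _ _ _ _ _ le_rfl le_rfl h1 h2 h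
  · intro c d c' d' hlt h h'
    refine glue _ _ _ _ _ _ _ _ _ _ _ _ ?_ h h'
    rw [← prod_union]
    exact prod_mono_right (cover hlt)
  · exact fun y => strip y a b

end Rectangle

end OpenString

namespace OpenString

/-! ### Local solutions -/

section LocalSolution

variable {α : OpenString} {Γ : Type*} [Group Γ] {X : ℝ → Γ}

theorem eventually_pos_iff {f : ℝ × ℝ → ℝ} {q : ℝ × ℝ} (hf : ContinuousAt f q) (h : f q ≠ 0) :
    ∀ᶠ z in 𝓝 q, (0 < f z ↔ 0 < f q) := by
  rcases h.lt_or_gt with h | h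
  · exact (hf.eventually_lt_const h).mono fun z hz => iff_of_false hz.not_gt h.not_gt
  · exact (hf.eventually_const_lt h).mono fun z hz => iff_of_true hz h

/-- Near a simple point of the curve, its two sides can be labeled. -/
theorem exists_isSolAt_of_notMem_doublePoints (s₀ : ℝ) (hX : ∀ᶠ s in 𝓝 s₀, X s = X s₀)
    (h₀ : α.curve s₀ ∉ α.doublePoints) : ∃ G, ∀ᶠ q in 𝓝 (α.curve s₀), IsSolAt α X G q := by
  classical
  obtain ⟨f, hf1, hf2, -⟩ := α.exists_side s₀
  refine ⟨fun z => if 0 < f z then 1 else X s₀, ?_⟩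
  have hK := eventually_forall_curve_eq (α := α) (p := α.curve s₀)
    (K := fun s => X s = X s₀ ∧ ∀ᶠ w in 𝓝 (s, 0), f (α.tube w) = w.2) (fun s hs => by
      obtain rfl : s = s₀ := by
        by_contra hne
        exact h₀ ⟨s, s₀, hne, hs, rfl⟩
      exact hX.and hf1)
  filter_upwards [hK, hf2] with q hq1 hq2
  refine ⟨fun hq => ⟨if 0 < f q then 1 else X s₀, ?_⟩, fun s hs => ⟨1, ?_⟩⟩
  · filter_upwards [eventually_pos_iff hq2.1 (mt hq2.2 hq)] with z hz _
    simp only [hz]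
  · obtain ⟨h1, h2⟩ := hq1 s hs
    filter_upwards [h2] with w hw _
    refine ⟨fun h => ?_, fun h => ?_⟩
    · simp [hw, h]
    · simp [hw, h.not_gt, h1]

/-- At a double point the four sectors can be labeled, as going from the left of both strands to the
right of both strands in the two possible ways gives the same result. -/
theorem exists_isSolAt_of_crossing {s₀ t₀ : ℝ} (hne : s₀ ≠ t₀) (hst : α.curve s₀ = α.curve t₀)
    (hdet : 0 < planeDet (deriv α.curve s₀) (deriv α.curve t₀)) {a b c d : Γ}
    (habcd : a * b = c * d) (hb : ∀ᶠ x in 𝓝[<] s₀, X x = b) (hc : ∀ᶠ x in 𝓝[>] s₀, X x = c)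
    (ha : ∀ᶠ x in 𝓝[<] t₀, X x = a) (hd : ∀ᶠ x in 𝓝[>] t₀, X x = d) :
    ∃ G, ∀ᶠ q in 𝓝 (α.curve s₀), q ∉ α.doublePoints → IsSolAt α X G q := by
  classical
  obtain ⟨f, hf1, hf2, hf3⟩ := α.exists_side s₀
  obtain ⟨f', hf1', hf2', hf3'⟩ := α.exists_side t₀
  have hs := (hf3' s₀ hst).2 (by simp only [planeDet] at hdet ⊢; linarith)
  have ht := (hf3 t₀ hst.symm).1 hdet
  rw [eventually_nhdsWithin_iff] at ha hb hc hd
  rw [← hst] at hf2'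
  refine ⟨fun z => if 0 < f z then (if 0 < f' z then 1 else d) else
    if 0 < f' z then b else a * b, ?_⟩
  have hK := eventually_forall_curve_eq (α := α) (p := α.curve s₀)
    (K := fun s => s = s₀ ∨ s = t₀ ∨
      ((∀ᶠ w in 𝓝 (s, 0), f (α.tube w) = w.2) ∧
        (0 < f' (α.curve s) ∧ X s = b ∨ f' (α.curve s) < 0 ∧ X s = c)) ∨
      ((∀ᶠ w in 𝓝 (s, 0), f' (α.tube w) = w.2) ∧
        (f (α.curve s) < 0 ∧ X s = a ∨ 0 < f (α.curve s) ∧ X s = d))) (fun s hs' => by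
      rcases α.no_triple s s₀ t₀ hs' hst with h | h | h
      · rw [h]
        filter_upwards [hf1, hs, hb, hc] with s h1 h2 h3 h4
        rcases lt_trichotomy s s₀ with h | h | h
        · rw [sign_pos (sub_pos.2 h), sign_eq_one_iff] at h2
          exact Or.inr (Or.inr (Or.inl ⟨h1, Or.inl ⟨h2, h3 h⟩⟩))
        · exact Or.inl h
        · rw [sign_neg (sub_neg.2 h), sign_eq_neg_one_iff] at h2
          exact Or.inr (Or.inr (Or.inl ⟨h1, Or.inr ⟨h2, h4 h⟩⟩))
      · exact absurd h hne
      · rw [h]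
        filter_upwards [hf1', ht, ha, hd] with t h1 h2 h3 h4
        rcases lt_trichotomy t t₀ with h | h | h
        · rw [sign_neg (sub_neg.2 h), sign_eq_neg_one_iff] at h2
          exact Or.inr (Or.inr (Or.inr ⟨h1, Or.inl ⟨h2, h3 h⟩⟩))
        · exact Or.inr (Or.inl h)
        · rw [sign_pos (sub_pos.2 h), sign_eq_one_iff] at h2
          exact Or.inr (Or.inr (Or.inr ⟨h1, Or.inr ⟨h2, h4 h⟩⟩)))
  filter_upwards [hK, hf2, hf2'] with q hq1 hq2 hq2' hqd
  refine ⟨fun hq => ⟨if 0 < f q then (if 0 < f' q then 1 else d) else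
    if 0 < f' q then b else a * b, ?_⟩, fun s hs => ?_⟩
  · filter_upwards [eventually_pos_iff hq2.1 (mt hq2.2 hq),
      eventually_pos_iff hq2'.1 (mt hq2'.2 hq)] with z hz hz' _
    simp only [hz, hz']
  · subst hs
    rcases hq1 s rfl with rfl | rfl | ⟨h1, h2⟩ | ⟨h1, h2⟩
    · exact absurd ⟨s, t₀, hne, rfl, hst.symm⟩ hqd
    · exact absurd ⟨s, s₀, hne.symm, rfl, hst⟩ hqd
    · rcases h2 with ⟨h2, h3⟩ | ⟨h2, h3⟩
      · refine ⟨1, ?_⟩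
        filter_upwards [h1, (continuousAt_tube s).eventually (eventually_pos_iff hq2'.1 h2.ne')]
          with w hw hw' _
        refine ⟨fun h => ?_, fun h => ?_⟩
        · simp [hw, hw', h, h2]
        · simp [hw, hw', h.not_gt, h2, h3]
      · refine ⟨d, ?_⟩
        filter_upwards [h1, (continuousAt_tube s).eventually (eventually_pos_iff hq2'.1 h2.ne)]
          with w hw hw' _
        refine ⟨fun h => ?_, fun h => ?_⟩
        · simp [hw, hw', h, h2.not_gt]
        · simp [hw, hw', h.not_gt, h2.not_gt, h3, habcd]
    · rcases h2 with ⟨h2, h3⟩ | ⟨h2, h3⟩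
      · refine ⟨b, ?_⟩
        filter_upwards [h1, (continuousAt_tube s).eventually (eventually_pos_iff hq2.1 h2.ne)]
          with w hw hw' _
        refine ⟨fun h => ?_, fun h => ?_⟩
        · simp [hw, hw', h, h2.not_gt]
        · simp [hw, hw', h.not_gt, h2.not_gt, h3]
      · refine ⟨1, ?_⟩
        filter_upwards [h1, (continuousAt_tube s).eventually (eventually_pos_iff hq2.1 h2.ne')]
          with w hw hw' _
        refine ⟨fun h => ?_, fun h => ?_⟩
        · simp [hw, hw', h, h2]
        · simp [hw, hw', h.not_gt, h2, h3]

/-- The labels `X` of the points of the curve are locally constant away from the double points, and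
at a double point the labels `b`, `c` before and after the strand that crosses from left to right
and `a`, `d` before and after the other strand satisfy `a * b = c * d`. -/
structure IsArcLabeling (α : OpenString) (X : ℝ → Γ) : Prop where
  regular : ∀ s, α.curve s ∉ α.doublePoints → ∀ᶠ x in 𝓝 s, X x = X s
  crossing : ∀ s t, s ≠ t → α.curve s = α.curve t →
    0 < planeDet (deriv α.curve s) (deriv α.curve t) → ∃ a b c d, a * b = c * d ∧
      (∀ᶠ x in 𝓝[<] s, X x = b) ∧ (∀ᶠ x in 𝓝[>] s, X x = c) ∧
      (∀ᶠ x in 𝓝[<] t, X x = a) ∧ ∀ᶠ x in 𝓝[>] t, X x = d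

theorem IsArcLabeling.exists_isSolAt (hX : IsArcLabeling α X) (p : ℝ × ℝ) :
    ∃ G, ∀ᶠ q in 𝓝 p, q ∉ α.doublePoints → IsSolAt α X G q := by
  by_cases hp : p ∈ α.image
  swap
  · refine ⟨1, ?_⟩
    filter_upwards [isClosed_image.isOpen_compl.mem_nhds hp] with q hq _
    exact ⟨fun _ => ⟨1, Eventually.of_forall fun _ _ => rfl⟩,
      fun s hs => absurd (hs ▸ curve_mem s) hq⟩
  obtain ⟨s, rfl⟩ := hp
  by_cases hd : α.curve s ∈ α.doublePoints
  swap
  · obtain ⟨G, hG⟩ := exists_isSolAt_of_notMem_doublePoints s (hX.regular s hd) hd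
    exact ⟨G, hG.mono fun q hq _ => hq⟩
  obtain ⟨x, y, hne, hx, hy⟩ := hd
  rw [← hx]
  rw [← hx] at hy
  rcases (α.transverse x y hne hy.symm).lt_or_gt with h | h
  · have h' : 0 < planeDet (deriv α.curve y) (deriv α.curve x) := by
      simp only [planeDet] at h ⊢
      linarith
    obtain ⟨a, b, c, d, h0, h1, h2, h3, h4⟩ := hX.crossing y x hne.symm hy h'
    rw [← hy]
    exact exists_isSolAt_of_crossing hne.symm hy h' h0 h1 h2 h3 h4
  · obtain ⟨a, b, c, d, h0, h1, h2, h3, h4⟩ := hX.crossing x y hne hy.symm h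
    exact exists_isSolAt_of_crossing hne hy.symm h h0 h1 h2 h3 h4

/-! ### The two ends of an open string -/

theorem IsSolOn.eq_of_mem_rectangle {G : ℝ × ℝ → Γ} {U : Set (ℝ × ℝ)} (h : IsSolOn α X G U)
    {a b c d : ℝ} (hU : Ioo a b ×ˢ Ioo c d ⊆ U) (hα : Disjoint (Ioo a b ×ˢ Ioo c d) α.image)
    {z z' : ℝ × ℝ} (hz : z ∈ Ioo a b ×ˢ Ioo c d) (hz' : z' ∈ Ioo a b ×ˢ Ioo c d) : G z = G z' := by
  have hconn : IsPreconnected (Ioo a b ×ˢ Ioo c d) := isPreconnected_Ioo.prod isPreconnected_Ioo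
  refine hconn.induction₂ (fun z z' => G z = G z') (fun x hx => ?_)
    (fun _ _ _ _ _ _ => Eq.trans) (fun _ _ _ _ => Eq.symm) hz hz'
  have hx' := disjoint_left.1 hα hx
  obtain ⟨g, hg⟩ := (h x (hU hx) fun h' => hx' (doublePoints_subset_image h')).off hx'
  rw [hg.self_of_nhds hx']
  filter_upwards [mem_nhdsWithin_of_mem_nhds hg, self_mem_nhdsWithin] with y hy hy'
  exact (hy (disjoint_left.1 hα hy')).symm

/-- The two ends of an open string have the same label: they have the same face on the left and the
same face on the right. -/
theorem IsArcLabeling.eventually_eq (hX : IsArcLabeling α X) :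
    ∀ᶠ x in atTop, X (-x) = X x := by
  obtain ⟨R, hR⟩ := α.standard
  obtain ⟨B₀, hB₀⟩ := (isCompact_Icc (a := -R) (b := R)).exists_bound_of_continuousOn
    α.smooth.continuous.continuousOn
  filter_upwards [eventually_gt_atTop (2 * max (max R B₀) 1)] with x hx
  -- the curve is standard outside of the square of radius `B`
  set B := max (max R B₀) 1 with hB
  have hB1 : (1 : ℝ) ≤ B := le_max_right _ _
  have hBR : R ≤ B := (le_max_left _ _).trans (le_max_left _ _)
  have hBB : B₀ ≤ B := (le_max_right _ _).trans (le_max_left _ _)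
  have himage : ∀ z ∈ α.image, z.2 = 0 ∨ (|z.1| ≤ B ∧ |z.2| ≤ B) := by
    rintro z ⟨s, rfl⟩
    rcases le_or_gt R |s| with h | h
    · rw [hR s h]
      exact Or.inl rfl
    · refine Or.inr ?_
      have := (hB₀ s (abs_le.1 h.le)).trans hBB
      rw [Prod.norm_def, max_le_iff] at this
      exact this
  have htube : ∀ s r : ℝ, R < |s| → α.tube (s, r) = (s, r) := by
    intro s r hs
    have hev : ∀ᶠ s' in 𝓝 s, α.curve s' = (s', 0) := by
      filter_upwards [continuous_abs.continuousAt.eventually_const_lt hs] with s' hs'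
      exact hR s' hs'.le
    have hder : HasDerivAt (fun s' : ℝ => (s', (0 : ℝ))) (1, 0) s :=
      (hasDerivAt_id s).prodMk (hasDerivAt_const s 0)
    have : deriv α.curve s = (1, 0) := (hder.congr_of_eventuallyEq hev).deriv
    simp [tube, this, hR s hs.le]
  obtain ⟨G, hG⟩ := exists_isSolOn_rectangle hX.exists_isSolAt (-(2 * x)) (2 * x) (-(2 * x)) (2 * x)
  -- the values of `G` near the ends
  have hend : ∀ s : ℝ, |s| = x → ∃ g, ∃ δ > 0, ∀ r : ℝ, (0 < r → r < δ → G (s, r) = g) ∧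
      (r < 0 → -δ < r → G (s, r) = X s * g) := by
    intro s hs
    have hsU : α.curve s = (s, 0) := hR s (by linarith)
    have hs' := abs_le.1 hs.le
    have hnd : α.curve s ∉ α.doublePoints := by
      rintro ⟨y, z, hyz, hy, hz⟩
      have key : ∀ y, α.curve y = α.curve s → y = s := by
        intro y hy
        rcases le_or_gt R |y| with h | h
        · rw [hR y h, hsU] at hy
          exact congrArg Prod.fst hy
        · have h2 := (hB₀ y (abs_le.1 h.le)).trans hBB
          rw [hy, hsU, Prod.norm_def, max_le_iff] at h2
          have h3 : |s| ≤ B := h2.1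
          linarith
      exact hyz ((key y hy).trans (key z hz).symm)
    obtain ⟨g, hg⟩ := (hG (α.curve s) (by
      rw [hsU]
      refine ⟨⟨?_, ?_⟩, ⟨?_, ?_⟩⟩ <;> dsimp only <;> linarith) hnd).jump s rfl
    have hc : Tendsto (fun r : ℝ => (s, r)) (𝓝 0) (𝓝 (s, 0)) :=
      (Continuous.prodMk_right s).tendsto 0
    obtain ⟨δ, hδ, h⟩ := Metric.eventually_nhds_iff_ball.1 (hc.eventually hg)
    rw [Real.ball_eq_Ioo, zero_sub, zero_add] at h
    have hoff : ∀ r : ℝ, r ≠ 0 → (s, r) ∉ α.image := fun r hr h' => by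
      rcases himage _ h' with h1 | h1
      · exact hr h1
      · have h2 : |s| ≤ B := h1.1
        linarith
    refine ⟨g, δ, hδ, fun r => ⟨fun h1 h2 => ?_, fun h1 h2 => ?_⟩⟩
    · have := h r ⟨by linarith, h2⟩
      rw [htube s r (by linarith)] at this
      exact (this (hoff r h1.ne')).1 h1
    · have := h r ⟨h2, by linarith⟩
      rw [htube s r (by linarith)] at this
      exact (this (hoff r h1.ne)).2 h1
  have hx0 : 0 < x := by linarith
  obtain ⟨g, δ, hδ, h⟩ := hend (-x) (by rw [abs_neg, abs_of_pos hx0])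
  obtain ⟨g', δ', hδ', h'⟩ := hend x (abs_of_pos hx0)
  -- both ends are joined above and below the curve, through the corners of the square of radius `x`
  have hrect : ∀ a b c d : ℝ, -(2 * x) ≤ a → b ≤ 2 * x → -(2 * x) ≤ c → d ≤ 2 * x →
      (0 ≤ c ∨ d ≤ 0) → (b ≤ -B ∨ B ≤ a ∨ B ≤ c ∨ d ≤ -B) → ∀ z z',
      z ∈ Ioo a b ×ˢ Ioo c d → z' ∈ Ioo a b ×ˢ Ioo c d → G z = G z' := by
    intro a b c d h1 h2 h3 h4 h5 h6 z z' hz hz'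
    refine hG.eq_of_mem_rectangle (prod_mono (Ioo_subset_Ioo h1 h2) (Ioo_subset_Ioo h3 h4))
      (disjoint_left.2 fun w hw hw' => ?_) hz hz'
    obtain ⟨⟨w1, w2⟩, ⟨w3, w4⟩⟩ := hw
    rcases himage w hw' with h | ⟨h, h'⟩
    · rcases h5 with h5 | h5 <;> linarith
    · rw [abs_le] at h h'
      rcases h6 with h6 | h6 | h6 | h6 <;> linarith
  set r := min (min δ δ') x / 2 with hr
  have hr0 : 0 < r := by positivity
  have hrm : 2 * r = min (min δ δ') x := by rw [hr]; ring
  have hr1 : r < δ := by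
    have := (min_le_left (min δ δ') x).trans (min_le_left _ _)
    linarith
  have hr2 : r < δ' := by
    have := (min_le_left (min δ δ') x).trans (min_le_right _ _)
    linarith
  have hr3 : r < x := by
    have := min_le_right (min δ δ') x
    linarith
  have hup : G (-x, r) = G (x, r) := by
    refine (hrect (-(2 * x)) (-B) 0 (2 * x) ?_ ?_ ?_ ?_ ?_ ?_ (-x, r) (-x, x) ?_ ?_).trans
      ((hrect (-(2 * x)) (2 * x) B (2 * x) ?_ ?_ ?_ ?_ ?_ ?_ (-x, x) (x, x) ?_ ?_).trans
      (hrect B (2 * x) 0 (2 * x) ?_ ?_ ?_ ?_ ?_ ?_ (x, x) (x, r) ?_ ?_))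
    all_goals first
      | (refine ⟨⟨?_, ?_⟩, ⟨?_, ?_⟩⟩ <;> dsimp only <;> linarith)
      | linarith
      | exact Or.inl (by linarith)
      | exact Or.inr (Or.inl (by linarith))
      | exact Or.inr (Or.inr (Or.inl (by linarith)))
  have hdown : G (-x, -r) = G (x, -r) := by
    refine (hrect (-(2 * x)) (-B) (-(2 * x)) 0 ?_ ?_ ?_ ?_ ?_ ?_ (-x, -r) (-x, -x) ?_ ?_).trans
      ((hrect (-(2 * x)) (2 * x) (-(2 * x)) (-B) ?_ ?_ ?_ ?_ ?_ ?_ (-x, -x) (x, -x) ?_ ?_).trans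
      (hrect B (2 * x) (-(2 * x)) 0 ?_ ?_ ?_ ?_ ?_ ?_ (x, -x) (x, -r) ?_ ?_))
    all_goals first
      | (refine ⟨⟨?_, ?_⟩, ⟨?_, ?_⟩⟩ <;> dsimp only <;> linarith)
      | linarith
      | exact Or.inl (by linarith)
      | exact Or.inr (by linarith)
      | exact Or.inr (Or.inl (by linarith))
      | exact Or.inr (Or.inr (Or.inr (by linarith)))
  rw [(h r).1 hr0 hr1, (h' r).1 hr0 hr2] at hup
  rw [(h (-r)).2 (by linarith) (by linarith), (h' (-r)).2 (by linarith) (by linarith), hup] at hdown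
  exact mul_right_cancel hdown

end LocalSolution

/-! ### Classical open strings -/

/-- The permutation `(n, g) ↦ (n - u, x_{n - u} g)`, for `u = (1, 0)`. It encodes the whole family
`x`, and composition of these permutations accounts for the shift in the crossing relations. -/
def familyPerm {A : Type*} [Group A] (x : ℤ × ℤ → A) : Equiv.Perm ((ℤ × ℤ) × A) where
  toFun y := (y.1 - (1, 0), x (y.1 - (1, 0)) * y.2)
  invFun y := (y.1 + (1, 0), (x y.1)⁻¹ * y.2)
  left_inv y := by simp
  right_inv y := by simp

theorem familyPerm_injective {A : Type*} [Group A] :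
    Function.Injective (familyPerm : (ℤ × ℤ → A) → Equiv.Perm ((ℤ × ℤ) × A)) := by
  intro x y h
  funext n
  have h' : x (n + (1, 0) - (1, 0)) * 1 = y (n + (1, 0) - (1, 0)) * 1 :=
    congrArg Prod.snd (DFunLike.congr_fun h (n + (1, 0), 1))
  rwa [add_sub_cancel_right, mul_one, mul_one] at h'

theorem familyPerm_mul_eq {A : Type*} [Group A] {a b c d : ℤ × ℤ → A}
    (h : ∀ n, a n * b (n + (1, 0)) = c n * d (n + (1, 0))) :
    familyPerm a * familyPerm b = familyPerm c * familyPerm d := by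
  refine Equiv.ext fun y => Prod.ext rfl ?_
  have := h (y.1 - (1, 0) - (1, 0))
  rw [sub_add_cancel] at this
  simp only [familyPerm, Equiv.Perm.mul_apply, Equiv.coe_fn_mk, ← mul_assoc, this]

theorem _root_.GaussDiagram.eventually_before_eq (D : GaussDiagram) (s : ℝ) :
    (∀ᶠ x in 𝓝[<] s, D.before x = D.before s) ∧ ∀ᶠ x in 𝓝[>] s, D.before x = D.after s := by
  have h1 : ∀ᶠ x in 𝓝[<] s, ∀ p ∈ D.points, p < s → p < x :=
    (Finset.eventually_all D.points).2 fun p _ => by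
      by_cases hp : p < s
      · filter_upwards [mem_nhdsWithin_of_mem_nhds (lt_mem_nhds hp)] with x hx _ using hx
      · exact Eventually.of_forall fun x h => absurd h hp
  have h2 : ∀ᶠ x in 𝓝[>] s, ∀ p ∈ D.points, p < x → p ≤ s :=
    (Finset.eventually_all D.points).2 fun p _ => by
      by_cases hp : s < p
      · filter_upwards [mem_nhdsWithin_of_mem_nhds (gt_mem_nhds hp)] with x hx h
        exact absurd h hx.not_gt
      · exact Eventually.of_forall fun x _ => not_lt.1 hp
  constructor
  · filter_upwards [h1, self_mem_nhdsWithin] with x hx hxs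
    refine Fin.ext (congrArg Finset.card (Finset.filter_congr fun p hp => ?_))
    exact ⟨fun h => lt_trans h hxs, hx p hp⟩
  · filter_upwards [h2, self_mem_nhdsWithin] with x hx hxs
    refine Fin.ext (congrArg Finset.card (Finset.filter_congr fun p hp => ?_))
    exact ⟨hx p hp, fun h => lt_of_le_of_lt h hxs⟩

theorem isArcLabeling_gen {α : OpenString} (hα : α.IsClassical) :
    IsArcLabeling α fun s => familyPerm (α.gauss.gen (α.gauss.before s)) := by
  refine ⟨fun s hs => ?_, fun s t hne hst hdet => ?_⟩
  · have hsp : s ∉ α.gauss.points := fun h => by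
      obtain ⟨e, he, h'⟩ := GaussDiagram.mem_points.1 h
      obtain ⟨h1, h2, -⟩ := (Set.Finite.mem_toFinset _).1 he
      rcases h' with rfl | rfl
      exacts [hs ⟨_, _, h1, rfl, h2.symm⟩, hs ⟨_, _, h1, h2, rfl⟩]
    obtain ⟨h1, h2⟩ := α.gauss.eventually_before_eq s
    rw [← α.gauss.before_eq_after hsp] at h2
    rw [← nhdsNE_sup_pure, ← nhdsLT_sup_nhdsGT]
    simp only [eventually_sup, eventually_pure, and_true]
    exact ⟨h1.mono fun x hx => by rw [hx], h2.mono fun x hx => by rw [hx]⟩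
  · have he : (s, t) ∈ α.gauss.arrows := by
      refine (Set.Finite.mem_toFinset _).2 ⟨hne, hst, ?_, hdet⟩
      rw [show α.circled = ∅ from hα]
      exact fun h => h
    obtain ⟨h1, h2⟩ := α.gauss.eventually_before_eq s
    obtain ⟨h3, h4⟩ := α.gauss.eventually_before_eq t
    exact ⟨_, _, _, _, familyPerm_mul_eq (GaussDiagram.gen_crossing he),
      h1.mono fun x hx => by rw [hx], h2.mono fun x hx => by rw [hx],
      h3.mono fun x hx => by rw [hx], h4.mono fun x hx => by rw [hx]⟩

theorem IsClassical.phi_eq_id {α : OpenString} (hα : α.IsClassical) :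
    α.Phi = MonoidHom.id (FreeGroup (ℤ × ℤ)) := by
  refine GaussDiagram.phi_eq_id_of_gen_eq ?_
  obtain ⟨x, h1, h2, h3⟩ := ((isArcLabeling_gen hα).eventually_eq.and
    ((tendsto_neg_atTop_atBot.eventually α.gauss.eventually_before_eq_zero).and
      α.gauss.eventually_before_eq_last)).exists
  have := familyPerm_injective h1
  rwa [h2, h3] at this

end OpenString

end

/-- If `α` is classical, then `Φ(α)` is the identity. Consequently, if `Φ(α)` is not the identity,
then `α` is not the same as any classical open string. -/
theorem corollary2p3 :
    (∀ α : OpenString, α.IsClassical → α.Phi = MonoidHom.id (FreeGroup (ℤ × ℤ))) ∧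
    (∀ α : OpenString, α.Phi ≠ MonoidHom.id (FreeGroup (ℤ × ℤ)) →
      ¬ ∃ β : OpenString, α.Same β ∧ β.IsClassical) := by
  refine ⟨fun α hα => hα.phi_eq_id, ?_⟩
  rintro α hα ⟨β, hαβ, hβ⟩
  exact hα (hαβ.phi_eq.trans hβ.phi_eq_id)
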